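/- Let $G$ be a finite-dimensional Lie group with Lie algebra $\mathfrak g$, let $\pi: P \to M$ be a finite-dimensional smooth right principal $G$-bundle over a closed (compact, boundaryless) $n$-dimensional manifold $M$ endowed with a volume form $\mu$ (which orients $M$), and let $(\bar F, \bar\omega, \bar J)$ be a finite-dimensional Hamiltonian $G$-manifold: a smooth left $G$-manifold with a $G$-invariant symplectic form $\bar\omega$ and a smooth $G$-equivariant map $\bar J: \bar F \to \mathfrak g^*$ (coadjoint action on $\mathfrak g^*$) such that $\bar\omega(A^*, \cdot) + d\langle A, \bar J\rangle = 0$ for all $A \in \mathfrak g$, where $A^*$ is the fundamental vector field of $A$. Let $F = P \times_G \bar F = (P\times\bar F)/\big((p,f)\sim(pg,g^{-1}f)\big)$, with vertical bundle $VF = P \times_G T\bar F$ and fibrewise symplectic form $\omega([p,u],[p,v]) = \bar\omega(u,v)$. Let $\mathcal F = \Gamma(F)$ be the Fréchet manifold of smooth sections of $F$, with $T_\phi\mathcal F = \Gamma(\phi^* VF)$ and with the symplectic form $\Omega_\phi(Z_1, Z_2) = \int_M \omega_\phi(Z_1, Z_2)\,\mu$. The gauge group $\mathrm{Gau}(P)$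 of smooth automorphisms of $P$ covering $\mathrm{id}_M$ acts on $\mathcal F$ by $\psi\cdot\phi = (\psi\times_G \mathrm{id}_{\bar F})\circ\phi$; its Lie algebra is $\mathfrak{gau}(P) = \Gamma(\mathrm{Ad} P)$, $\mathrm{Ad} P = P \times_G \mathfrak g$, where $[p,A]$ corresponds to the vertical vector $p\cdot A\in T_pP$. (i) The infinitesimal generator of $Y \in \mathfrak{gau}(P)$ is the vector field $Y^*$ on $\mathcal F$ with $Y^*_\phi(m) = [p, A^*_f]$ whenever $Y(m) = [p,A]$ and $\phi(m) = [p,f]$: for every smooth curve $\psi_t$ in $\mathrm{Gau}(P)$ with $\psi_0 = \mathrm{id}$ and velocity $Y$ at $t=0$, the curve $\psi_t\cdot\phi$ in $\mathcal F$ is smooth and has velocity $Y^*_\phi$ at $t=0$. (ii) With $\mathrm{Ad}^*P = P\times_G\mathfrak g^*$, the pairing $\langle Y, \eta\rangle_{\mathrm{Ad}} = \int_M \langle Y(m), \eta(m)\rangle\, \mu(m)$ of $\Gamma(\mathrm{Ad} P)$ and $\Gamma(\mathrm{Ad}^* P)$ is well defined, bilinear and weakly non-degenerate. (iii) Let $J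 = \mathrm{id}_P\times_G\bar J : F \to \mathrm{Ad}^* P$, $[p,f]\mapsto[p,\bar J(f)]$. The map $\mathcal J: \mathcal F \to \Gamma(\mathrm{Ad}^* P)$, $\phi \mapsto J_*\phi = J \circ \phi$, is a momentum map for the action of $\mathrm{Gau}(P)$ on $(\mathcal F, \Omega)$: it is smooth, and for all $Y \in \mathfrak{gau}(P)$ and $\phi\in\mathcal F$ the vector $Y^*_\phi$ lies in $\Gamma(\phi^*VF)$ and $$\Omega_\phi(Y^*_\phi, Z) + d\big(\langle Y, \mathcal J(\cdot)\rangle_{\mathrm{Ad}}\big)_\phi(Z) = 0 ,$$ that is, for every smooth curve in $\mathcal F$ through $\phi$ with velocity $Z \in \Gamma(\phi^* VF)$, the derivative of $\langle Y, \mathcal J(\cdot)\rangle_{\mathrm{Ad}}$ along the curve is $-\Omega_\phi(Y^*_\phi,Z)$. Moreover, for every $Z\in\Gamma(\phi^*VF)$ one has $\Omega_\phi(Y^*_\phi,Z)+\int_M\langle Y,(\partial J)(Z)\rangle\,\mu=0$, where $\partial J([p,u]) = [p, T\bar J(u)]$ is the fibre derivative of $J$. (iv) If $Y(m) = [p_m,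 A_m]$ and $\phi(m) = [p_m, f_m]$ with $p_m\in P$ over $m$ for all $m\in M$, then $$\langle Y, \mathcal J(\phi)\rangle_{\mathrm{Ad}} = \int_M \langle Y(m), (\mathrm{id}_P\times_G \bar J)(\phi(m))\rangle\,\mu(m) = \int_M \langle A_m, \bar J(f_m)\rangle\,\mu(m).$$ -/

import Mathlib

open scoped Manifold ContDiff Topology RightActions

noncomputable section

namespace GaugeMomentum

section Forms

variable {E : Type*} [NormedAddCommGroup E] [NormedSpace ℝ E] {H : Type*} [TopologicalSpace H]
  (I : ModelWithCorners ℝ E H) {N : Type*} [TopologicalSpace N] [ChartedSpace H N] {k : ℕ}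

/-- The coordinate representation, in the chart around `x₀`, of a field of alternating `k`-forms:
its pull-back along the inverse of the chart. -/
def formInChart (α : ∀ x : N, TangentSpace I x [⋀^Fin k]→L[ℝ] ℝ) (x₀ : N) (y : E) :
    E [⋀^Fin k]→L[ℝ] ℝ :=
  (α ((extChartAt I x₀).symm y)).compContinuousLinearMap
    (mfderiv 𝓘(ℝ, E) I (extChartAt I x₀).symm y)

/-- A differential form is smooth if all its coordinate representations are. -/
def IsSmoothForm (α : ∀ x : N, TangentSpace I x [⋀^Fin k]→L[ℝ] ℝ) : Prop :=
  ∀ x₀ : N, ContDiffOn ℝ ∞ (formInChart I α x₀) (extChartAt I x₀).target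

/-- A differential form is closed if all its coordinate representations are. -/
def IsClosedForm (α : ∀ x : N, TangentSpace I x [⋀^Fin k]→L[ℝ] ℝ) : Prop :=
  ∀ x₀ : N, ∀ y ∈ (extChartAt I x₀).target, extDeriv (formInChart I α x₀) y = 0

end Forms

section Volume

variable (n : ℕ) (M : Type*) [TopologicalSpace M] [ChartedSpace (EuclideanSpace ℝ (Fin n)) M]

/-- A volume form on an `n`-dimensional manifold: a smooth, nowhere vanishing `n`-form. -/
structure VolumeForm where
  form : ∀ x : M, TangentSpace (𝓡 n) x [⋀^Fin n]→L[ℝ] ℝ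
  smooth : IsSmoothForm (𝓡 n) form
  form_ne_zero : ∀ x, form x ≠ 0

variable {n M}

/-- The measure which a volume form induces on a chart domain: Lebesgue measure in the coordinates,
weighted with the absolute value of the coefficient of the form. -/
def VolumeForm.chartMeasure [MeasurableSpace M] (μ : VolumeForm n M) (x₀ : M) :
    MeasureTheory.Measure M :=
  MeasureTheory.Measure.map (extChartAt (𝓡 n) x₀).symm
    ((MeasureTheory.volume.restrict (extChartAt (𝓡 n) x₀).target).withDensity fun y =>
      ENNReal.ofReal |formInChart (𝓡 n) μ.form x₀ y fun i => EuclideanSpace.single i (1 : ℝ)|)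

variable [IsManifold (𝓡 n) ∞ M] [T2Space M] [SigmaCompactSpace M]

variable (n M) in
/-- A smooth partition of unity subordinate to the chart domains. -/
def chartPartition : SmoothPartitionOfUnity M (𝓡 n) M Set.univ :=
  (SmoothPartitionOfUnity.exists_isSubordinate_chartAt_source (𝓡 n) M).choose

/-- The measure on `M` such that `∫ f ∂(μ.measure)` is the integral of the form `f μ` over `M`, the
manifold being oriented by `μ`. As usual, it is obtained by cutting `f` into pieces which are
supported in chart domains by means of a partition of unity (the result does not depend on the
partition and on the charts). -/
def VolumeForm.measure [MeasurableSpace M] (μ : VolumeForm n M) : MeasureTheory.Measure M :=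
  MeasureTheory.Measure.sum fun x₀ : M =>
    (μ.chartMeasure x₀).withDensity fun m => ENNReal.ofReal (chartPartition n M x₀ m)

end Volume

section LieGroup

variable {EG : Type*} [NormedAddCommGroup EG] [NormedSpace ℝ EG]
  {G : Type*} [Group G] [TopologicalSpace G] [ChartedSpace EG G]

/-- The adjoint action `Ad g = T₁(x ↦ g x g⁻¹)` on the Lie algebra `T₁G`. All tangent spaces of `G`
are the model space `EG` by definition; `EG` stands for `T₁G = Lie(G)` throughout. -/
def Ad (g : G) : EG →L[ℝ] EG :=
  (mfderiv 𝓘(ℝ, EG) 𝓘(ℝ, EG) (fun x : G => g * x * g⁻¹) 1 : EG →L[ℝ] EG)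

/-- The adjoint action as a map `G → 𝔤 → 𝔤`. -/
def adAction (g : G) (A : EG) : EG := Ad g A

/-- The left coadjoint action `⟨g · α, A⟩ = ⟨α, Ad (g⁻¹) A⟩` on the dual of the Lie algebra. -/
def coadAction (g : G) (α : EG →L[ℝ] ℝ) : EG →L[ℝ] ℝ := α.comp (Ad g⁻¹)

variable {EF : Type*} [NormedAddCommGroup EF] [NormedSpace ℝ EF]
  {F : Type*} [TopologicalSpace F] [ChartedSpace EF F] [MulAction G F]

/-- The fundamental vector `A^*_f = d/dt (exp (tA) · f) = T₁(g ↦ g · f) A` at `f = 1 · f`. -/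
def fundamentalVector (G : Type*) [Group G] [TopologicalSpace G] [ChartedSpace EG G] [MulAction G F]
    (A : EG) (f : F) : TangentSpace 𝓘(ℝ, EF) f :=
  (mfderiv 𝓘(ℝ, EG) 𝓘(ℝ, EF) (fun g : G => g • f) 1 : EG →L[ℝ] EF) A

/-- The induced action of `G` on the tangent bundle of a `G`-manifold. -/
def tangentAction (g : G) (v : TangentBundle 𝓘(ℝ, EF) F) : TangentBundle 𝓘(ℝ, EF) F :=
  tangentMap 𝓘(ℝ, EF) 𝓘(ℝ, EF) (fun f : F => g • f) v

/-- The action map `G → F → F` of a `G`-space. -/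
def leftAction (g : G) (f : F) : F := g • f

variable (EG G EF F) in
/-- A Hamiltonian `G`-manifold structure on the `G`-manifold `F`: an invariant symplectic form and
an equivariant momentum map. -/
structure HamiltonianStructure where
  /-- the symplectic form -/
  form : ∀ f : F, TangentSpace 𝓘(ℝ, EF) f [⋀^Fin 2]→L[ℝ] ℝ
  smooth_form : IsSmoothForm 𝓘(ℝ, EF) form
  closed_form : IsClosedForm 𝓘(ℝ, EF) form
  nondegenerate : ∀ (f : F) (u : TangentSpace 𝓘(ℝ, EF) f), (∀ v, form f ![u, v] = 0) → u = 0
  invariant : ∀ (g : G) (f : F) (u v : TangentSpace 𝓘(ℝ, EF) f),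
    form (g • f) ![mfderiv 𝓘(ℝ, EF) 𝓘(ℝ, EF) (fun x : F => g • x) f u,
      mfderiv 𝓘(ℝ, EF) 𝓘(ℝ, EF) (fun x : F => g • x) f v] = form f ![u, v]
  /-- the momentum map -/
  J : F → (EG →L[ℝ] ℝ)
  smooth_J : ContMDiff 𝓘(ℝ, EF) 𝓘(ℝ, EG →L[ℝ] ℝ) ∞ J
  equivariant_J : ∀ (g : G) (f : F), J (g • f) = coadAction g (J f)
  momentum : ∀ (A : EG) (f : F) (u : TangentSpace 𝓘(ℝ, EF) f),
    form f ![fundamentalVector G A f, u]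
      + (show EG →L[ℝ] ℝ from mfderiv 𝓘(ℝ, EF) 𝓘(ℝ, EG →L[ℝ] ℝ) J f u) A = 0

/-- The symplectic form evaluated at two elements `a`, `b` of the tangent bundle with the same base
point. -/
def HamiltonianStructure.eval (S : HamiltonianStructure EG G EF F)
    (a b : TangentBundle 𝓘(ℝ, EF) F) : ℝ :=
  S.form a.proj ![a.snd, (show EF from b.snd)]

end LieGroup

/-- A smooth right principal `G`-bundle `P → M`: a fibre-preserving smooth right action which is
free and transitive on the fibres, such that `P` is locally equivariantly diffeomorphic to the
product with `G`. -/
structure PrincipalBundle (n : ℕ) (EG EP G P M : Type*)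
    [NormedAddCommGroup EG] [NormedSpace ℝ EG] [NormedAddCommGroup EP] [NormedSpace ℝ EP]
    [Group G] [TopologicalSpace G] [ChartedSpace EG G]
    [TopologicalSpace P] [ChartedSpace EP P] [MulAction Gᵐᵒᵖ P]
    [TopologicalSpace M] [ChartedSpace (EuclideanSpace ℝ (Fin n)) M] where
  proj : P → M
  smooth_proj : ContMDiff 𝓘(ℝ, EP) (𝓡 n) ∞ proj
  smooth_action : ContMDiff (𝓘(ℝ, EP).prod 𝓘(ℝ, EG)) 𝓘(ℝ, EP) ∞ (fun x : P × G => x.1 <• x.2)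
  free : ∀ (p : P) (g : G), p <• g = p → g = 1
  proj_eq_iff : ∀ p q : P, proj p = proj q ↔ ∃ g : G, q = p <• g
  locally_trivial : ∀ m : M, ∃ (U : Set M) (e : PartialEquiv P (M × G)), IsOpen U ∧ m ∈ U ∧
    e.source = proj ⁻¹' U ∧ e.target = U ×ˢ Set.univ ∧
    ContMDiffOn 𝓘(ℝ, EP) ((𝓡 n).prod 𝓘(ℝ, EG)) ∞ e e.source ∧
    ContMDiffOn ((𝓡 n).prod 𝓘(ℝ, EG)) 𝓘(ℝ, EP) ∞ e.symm e.target ∧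
    ∀ p ∈ e.source, (e p).1 = proj p ∧ ∀ g : G, e (p <• g) = ((e p).1, (e p).2 * g)

namespace PrincipalBundle

variable {n : ℕ} {EG EP G P M : Type*}
  [NormedAddCommGroup EG] [NormedSpace ℝ EG] [NormedAddCommGroup EP] [NormedSpace ℝ EP]
  [Group G] [TopologicalSpace G] [ChartedSpace EG G]
  [TopologicalSpace P] [ChartedSpace EP P] [MulAction Gᵐᵒᵖ P]
  [TopologicalSpace M] [ChartedSpace (EuclideanSpace ℝ (Fin n)) M]
  (B : PrincipalBundle n EG EP G P M)

theorem proj_smul (p : P) (g : G) : B.proj (p <• g) = B.proj p :=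
  ((B.proj_eq_iff p (p <• g)).2 ⟨g, rfl⟩).symm

theorem exists_proj_eq (m : M) : ∃ p : P, B.proj p = m := by
  obtain ⟨U, e, -, hm, hs, ht, -, -, h⟩ := B.locally_trivial m
  have hmem : ((m, 1) : M × G) ∈ e.target := by rw [ht]; exact ⟨hm, trivial⟩
  refine ⟨e.symm (m, 1), ?_⟩
  have := (h _ (e.map_target hmem)).1
  rw [e.right_inv hmem] at this
  exact this.symm

/-- A point of `P` over `m`. -/
def point (m : M) : P := (B.exists_proj_eq m).choose

theorem proj_point (m : M) : B.proj (B.point m) = m := (B.exists_proj_eq m).choose_spec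

/-! ### Associated bundles -/

section Assoc

variable {X : Type*}

/-- The associated bundle `P ×_G X`: the quotient of `P × X` by `(p, x) ∼ (p g, g⁻¹ x)`, where
`ρ : G → X → X` is the left action of `G` on the typical fibre `X`. -/
def Assoc (_B : PrincipalBundle n EG EP G P M) (ρ : G → X → X) : Type _ :=
  Quot fun a b : P × X => ∃ g : G, b = (a.1 <• g, ρ g⁻¹ a.2)

/-- The class `[p, x]`. -/
def cls (ρ : G → X → X) (p : P) (x : X) : B.Assoc ρ := Quot.mk _ (p, x)

/-- The projection `P ×_G X → M`. -/
def assocProj {ρ : G → X → X} : B.Assoc ρ → M :=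
  Quot.lift (fun a => B.proj a.1) (by
    rintro a b ⟨g, rfl⟩
    exact (B.proj_smul a.1 g).symm)

/-- The bundle map `id_P ×_G j : [p, x] ↦ [p, j x]` induced by an equivariant map `j`. -/
def assocMap {X' : Type*} {ρ : G → X → X} {ρ' : G → X' → X'} (j : X → X')
    (hj : ∀ g x, j (ρ g x) = ρ' g (j x)) : B.Assoc ρ → B.Assoc ρ' :=
  Quot.map (fun a => (a.1, j a.2)) (by
    rintro a b ⟨g, rfl⟩
    exact ⟨g, by simp [hj]⟩)

theorem exists_cls_eq {ρ : G → X → X} (p : P) (a : B.Assoc ρ) (h : B.assocProj a = B.proj p) :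
    ∃ x, B.cls ρ p x = a := by
  induction a using Quot.ind with
  | mk a =>
    obtain ⟨g, hg⟩ := (B.proj_eq_iff a.1 p).1 h
    refine ⟨ρ g⁻¹ a.2, ?_⟩
    subst hg
    exact (Quot.sound ⟨g, rfl⟩).symm

variable {EX HX : Type*} [NormedAddCommGroup EX] [NormedSpace ℝ EX] [TopologicalSpace HX]
  (IX : ModelWithCorners ℝ EX HX) [TopologicalSpace X] [ChartedSpace HX X]

/-- Smoothness of a map `s : N → P ×_G X` on a manifold `N`. The manifold structure of `P ×_G X` is
the one for which the quotient map `P × X → P ×_G X` is a surjective submersion; hence `s` is smooth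
if and only if it lifts, locally, to a smooth map into `P × X`. -/
def SmoothInto {ρ : G → X → X} {EN HN N : Type*} [NormedAddCommGroup EN] [NormedSpace ℝ EN]
    [TopologicalSpace HN] (IN : ModelWithCorners ℝ EN HN) [TopologicalSpace N] [ChartedSpace HN N]
    (s : N → B.Assoc ρ) : Prop :=
  ∀ y : N, ∃ U ∈ 𝓝 y, ∃ (a : N → P) (x : N → X), ContMDiffOn IN 𝓘(ℝ, EP) ∞ a U ∧
    ContMDiffOn IN IX ∞ x U ∧ ∀ z ∈ U, s z = B.cls ρ (a z) (x z)

/-- A (not necessarily smooth) section of `P ×_G X`. -/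
@[ext]
structure Sec {X : Type*} (ρ : G → X → X) where
  toFun : M → B.Assoc ρ
  proj_toFun : ∀ m, B.assocProj (toFun m) = m

/-- For a section `s` and `p ∈ P` over `m`, the element `x` of the typical fibre such that
`s m = [p, x]`, that is, the preimage of `s m` under the fibre injection `x ↦ [p, x]`. -/
def Sec.at {B : PrincipalBundle n EG EP G P M} {X : Type*} {ρ : G → X → X} (s : B.Sec ρ) (p : P) :
    X :=
  (B.exists_cls_eq p (s.toFun (B.proj p)) (s.proj_toFun _)).choose

theorem Sec.cls_at {B : PrincipalBundle n EG EP G P M} {X : Type*} {ρ : G → X → X} (s : B.Sec ρ)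
    (p : P) : B.cls ρ p (s.at p) = s.toFun (B.proj p) :=
  (B.exists_cls_eq p (s.toFun (B.proj p)) (s.proj_toFun _)).choose_spec

/-- The space `Γ(P ×_G X)` of smooth sections. -/
@[ext]
structure SmoothSec (ρ : G → X → X) extends B.Sec ρ where
  smooth : B.SmoothInto IX (𝓡 n) toFun

variable {B IX} {ρ : G → X → X}

/-- A smooth family, parametrized by a manifold `N`, of smooth sections: `(y, m) ↦ c y m` is smooth
as a map on `N × M`. For `N = ℝ` these are the smooth curves in the Fréchet manifold of sections. -/
def IsSmoothFamily {EN HN N : Type*} [NormedAddCommGroup EN] [NormedSpace ℝ EN]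
    [TopologicalSpace HN] (IN : ModelWithCorners ℝ EN HN) [TopologicalSpace N] [ChartedSpace HN N]
    (c : N → B.SmoothSec IX ρ) : Prop :=
  B.SmoothInto IX (IN.prod (𝓡 n)) fun z : N × M => (c z.1).toFun z.2

/-- Smoothness of a map between spaces of sections: smooth finite-dimensional families are mapped
to smooth families (for the Fréchet manifolds of sections over a compact base, this is smoothness in
the sense of the calculus on Fréchet manifolds). -/
def IsSmoothMap {X' EX' HX' : Type*} [NormedAddCommGroup EX'] [NormedSpace ℝ EX']
    [TopologicalSpace HX'] {IX' : ModelWithCorners ℝ EX' HX'} [TopologicalSpace X']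
    [ChartedSpace HX' X'] {ρ' : G → X' → X'}
    (T : B.SmoothSec IX ρ → B.SmoothSec IX' ρ') : Prop :=
  ∀ (k : ℕ) (c : EuclideanSpace ℝ (Fin k) → B.SmoothSec IX ρ),
    IsSmoothFamily (𝓡 k) c → IsSmoothFamily (𝓡 k) fun y => T (c y)

/-- The map `s ↦ j_* s = (id_P ×_G j) ∘ s` on sections induced by a smooth equivariant map `j`. -/
def pushforward {X' EX' HX' : Type*} [NormedAddCommGroup EX'] [NormedSpace ℝ EX']
    [TopologicalSpace HX'] {IX' : ModelWithCorners ℝ EX' HX'} [TopologicalSpace X']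
    [ChartedSpace HX' X'] {ρ' : G → X' → X'} (j : X → X') (hj : ∀ g x, j (ρ g x) = ρ' g (j x))
    (hsm : ContMDiff IX IX' ∞ j) (s : B.SmoothSec IX ρ) : B.SmoothSec IX' ρ' where
  toFun m := B.assocMap j hj (s.toFun m)
  proj_toFun m := by
    obtain ⟨p, hp⟩ := B.exists_proj_eq m
    subst hp
    rw [← s.cls_at p]
    rfl
  smooth y := by
    obtain ⟨U, hU, a, x, ha, hx, h⟩ := s.smooth y
    refine ⟨U, hU, a, fun z => j (x z), ha, hsm.comp_contMDiffOn hx, fun z hz => ?_⟩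
    change B.assocMap j hj (s.toFun z) = _
    rw [h z hz]
    rfl

end Assoc

/-! ### The gauge group and its action -/

/-- The gauge group: the smooth automorphisms of the principal bundle covering the identity. -/
def GaugeGroup : Subgroup (Equiv.Perm P) where
  carrier := {ψ | ContMDiff 𝓘(ℝ, EP) 𝓘(ℝ, EP) ∞ ψ ∧ ContMDiff 𝓘(ℝ, EP) 𝓘(ℝ, EP) ∞ ψ.symm ∧
    (∀ (p : P) (g : G), ψ (p <• g) = ψ p <• g) ∧ ∀ p, B.proj (ψ p) = B.proj p}
  mul_mem' := by
    rintro ψ χ ⟨h1, h2, h3, h4⟩ ⟨k1, k2, k3, k4⟩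
    exact ⟨h1.comp k1, k2.comp h2, fun p g => by simp [h3, k3], fun p => by simp [h4, k4]⟩
  one_mem' := ⟨contMDiff_id, contMDiff_id, fun _ _ => rfl, fun _ => rfl⟩
  inv_mem' := by
    rintro ψ ⟨h1, h2, h3, h4⟩
    refine ⟨h2, h1, fun p g => ?_, fun p => ?_⟩
    · apply ψ.injective
      rw [h3]
      simp
    · have := h4 (ψ⁻¹ p)
      simpa using this.symm

variable {B} in
/-- The bundle automorphism `ψ ×_G id : [p, x] ↦ [ψ p, x]` of `P ×_G X`. -/
def gaugeMap {X : Type*} {ρ : G → X → X} (ψ : B.GaugeGroup) : B.Assoc ρ → B.Assoc ρ :=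
  Quot.map (fun a => (ψ.1 a.1, a.2)) (by
    rintro a b ⟨g, rfl⟩
    exact ⟨g, by simp [ψ.2.2.2.1]⟩)

section Action

variable {EX HX X : Type*} [NormedAddCommGroup EX] [NormedSpace ℝ EX] [TopologicalSpace HX]
  {IX : ModelWithCorners ℝ EX HX} [TopologicalSpace X] [ChartedSpace HX X] {ρ : G → X → X}

/-- The action `ψ · φ = (ψ ×_G id) ∘ φ` of the gauge group on the space of sections. -/
instance : MulAction B.GaugeGroup (B.SmoothSec IX ρ) where
  smul ψ s :=
    { toFun := fun m => gaugeMap ψ (s.toFun m)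
      proj_toFun := fun m => by
        obtain ⟨p, hp⟩ := B.exists_proj_eq m
        subst hp
        rw [← s.cls_at p]
        exact ψ.2.2.2.2 p
      smooth := fun y => by
        obtain ⟨U, hU, a, x, ha, hx, h⟩ := s.smooth y
        refine ⟨U, hU, fun z => ψ.1 (a z), x, ψ.2.1.comp_contMDiffOn ha, hx, fun z hz => ?_⟩
        change gaugeMap ψ (s.toFun z) = _
        rw [h z hz]
        rfl }
  one_smul s := by
    apply SmoothSec.ext
    funext m
    change gaugeMap 1 (s.toFun m) = s.toFun m
    induction s.toFun m using Quot.ind with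
    | mk a => rfl
  mul_smul ψ χ s := by
    apply SmoothSec.ext
    funext m
    change gaugeMap (ψ * χ) (s.toFun m) = gaugeMap ψ (gaugeMap χ (s.toFun m))
    induction s.toFun m using Quot.ind with
    | mk a => rfl

end Action

/-- The gauge algebra `Γ(Ad P)`, where `Ad P = P ×_G 𝔤`. -/
abbrev GaugeAlgebra : Type _ := B.SmoothSec 𝓘(ℝ, EG) (adAction : G → EG → EG)

/-- The dual gauge algebra `Γ(Ad^* P)`, where `Ad^* P = P ×_G 𝔤^*`. -/
abbrev CoGaugeAlgebra : Type _ :=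
  B.SmoothSec 𝓘(ℝ, EG →L[ℝ] ℝ) (coadAction : G → (EG →L[ℝ] ℝ) → (EG →L[ℝ] ℝ))

variable {B}

/-- A smooth curve of gauge transformations which passes through the identity at `t = 0` with
velocity `Y ∈ Γ(Ad P)`. Here `[p, A] ∈ Ad P` stands for the vertical tangent vector
`p · A = d/dt (p exp (tA))` at `p = p · 1`. -/
def IsGaugeCurve (ψ : ℝ → B.GaugeGroup) (Y : B.GaugeAlgebra) : Prop :=
  ContMDiff (𝓘(ℝ, ℝ).prod 𝓘(ℝ, EP)) 𝓘(ℝ, EP) ∞ (fun z : ℝ × P => (ψ z.1).1 z.2) ∧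
  ψ 0 = 1 ∧
  ∀ p : P, tangentMap 𝓘(ℝ, ℝ) 𝓘(ℝ, EP) (fun t : ℝ => (ψ t).1 p) ⟨0, (1 : ℝ)⟩ =
    tangentMap 𝓘(ℝ, EG) 𝓘(ℝ, EP) (fun g : G => p <• g) ⟨1, (Y.at p : EG)⟩

/-- The fibrewise pairing `⟨[p, A], [p, α]⟩ = α A` of `Y m ∈ Ad P` and `η m ∈ Ad^* P`. -/
def fibrePairing (Y : B.GaugeAlgebra) (η : B.CoGaugeAlgebra) (m : M) : ℝ :=
  η.at (B.point m) (Y.at (B.point m))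

/-! ### The symplectic space of sections -/

section Sections

variable {EF F : Type*} [NormedAddCommGroup EF] [NormedSpace ℝ EF]
  [TopologicalSpace F] [ChartedSpace EF F] [IsManifold 𝓘(ℝ, EF) ∞ F] [MulAction G F]

variable (B EF F) in
/-- The space of smooth sections of the associated bundle `P ×_G F`. -/
abbrev Sections : Type _ := B.SmoothSec 𝓘(ℝ, EF) (leftAction : G → F → F)

variable (B EF F) in
/-- (Set-theoretic) sections of the vertical bundle `P ×_G TF` of `P ×_G F`, as a bundle
over `M`. -/
abbrev VerticalSec : Type _ :=
  B.Sec (tangentAction : G → TangentBundle 𝓘(ℝ, EF) F → TangentBundle 𝓘(ℝ, EF) F)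

/-- The tangent space at the section `φ`: smooth sections `Z` of the pull-back by `φ` of the
vertical bundle `P ×_G TF → P ×_G F`, `[p, u] ↦ [p, f]` for `u ∈ T_f F`. -/
structure TangentVector (φ : B.Sections EF F) extends
    B.SmoothSec 𝓘(ℝ, EF).tangent
      (tangentAction : G → TangentBundle 𝓘(ℝ, EF) F → TangentBundle 𝓘(ℝ, EF) F) where
  base_eq : ∀ m, B.assocMap (ρ' := (leftAction : G → F → F)) Bundle.TotalSpace.proj
    (fun _ _ => rfl) (toFun m) = φ.toFun m

/-- The velocity at time `t` of a curve of sections: if `c s m = [p, f s]`, it is given at `m` by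
`[p, f' t]`. -/
def velocity (c : ℝ → B.Sections EF F) (t : ℝ) : B.VerticalSec EF F where
  toFun m := B.cls _ (B.point m)
    (tangentMap 𝓘(ℝ, ℝ) 𝓘(ℝ, EF) (fun s : ℝ => (c s).at (B.point m)) ⟨t, (1 : ℝ)⟩)
  proj_toFun m := B.proj_point m

/-- The infinitesimal generator `Y^*` at `φ` of the action of the gauge group on the space of
sections: if `Y m = [p, A]` and `φ m = [p, f]`, it is given at `m` by `[p, A^*_f]`. -/
def generator (Y : B.GaugeAlgebra) (φ : B.Sections EF F) : B.VerticalSec EF F where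
  toFun m := B.cls _ (B.point m)
    ⟨φ.at (B.point m), fundamentalVector G (Y.at (B.point m)) (φ.at (B.point m))⟩
  proj_toFun m := B.proj_point m

/-- The function `ω(Z₁, Z₂)` on `M`, for vertical fields `Z₁`, `Z₂` along the same section. Here
`ω` is the fibrewise symplectic form, for which the maps `f ↦ [p, f]` are symplectomorphisms. -/
def fibreForm (S : HamiltonianStructure EG G EF F) (Z₁ Z₂ : B.VerticalSec EF F) (m : M) : ℝ :=
  S.eval (Z₁.at (B.point m)) (Z₂.at (B.point m))

/-- The function `⟨Y, T J (Z)⟩` on `M`, for `Y ∈ Γ(Ad P)` and a vertical field `Z`: if `Y m = [p, A]`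
and `Z m = [p, u]` with `u ∈ T_f F`, its value at `m` is `⟨A, T_f J (u)⟩`. -/
def fibreDerivPairing (S : HamiltonianStructure EG G EF F) (Y : B.GaugeAlgebra)
    (Z : B.VerticalSec EF F) (m : M) : ℝ :=
  (show EG →L[ℝ] ℝ from mfderiv 𝓘(ℝ, EF) 𝓘(ℝ, EG →L[ℝ] ℝ) S.J (Z.at (B.point m)).proj
    (Z.at (B.point m)).snd) (Y.at (B.point m))

/-- `d` is the differential at `φ` of the function `h` on the manifold of sections: along every
smooth curve through `φ` with velocity `Z`, the derivative of `h` is `d Z`. -/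
def HasDifferentialAt (h : B.Sections EF F → ℝ) (φ : B.Sections EF F) (d : TangentVector φ → ℝ) :
    Prop :=
  ∀ (Z : TangentVector φ) (c : ℝ → B.Sections EF F), IsSmoothFamily 𝓘(ℝ, ℝ) c → c 0 = φ →
    velocity c 0 = Z.toSec → HasDerivAt (fun t => h (c t)) (d Z) 0

variable (B EF F) in
/-- The vector field `Y^*` generates the action of the gauge group on the space of sections: for
every smooth curve `ψ` of gauge transformations with `ψ 0 = id` and velocity `Y` (for example,
`ψ t = exp (tY)`), the curve `t ↦ ψ t · φ` is a smooth curve in the space of sections, whose velocity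
at `t = 0` is `Y^*_φ`. -/
def GeneratesGaugeAction : Prop :=
  ∀ (Y : B.GaugeAlgebra) (φ : B.Sections EF F) (ψ : ℝ → B.GaugeGroup), IsGaugeCurve ψ Y →
    IsSmoothFamily 𝓘(ℝ, ℝ) (fun t => ψ t • φ) ∧ velocity (fun t => ψ t • φ) 0 = generator Y φ

/-- The bundle momentum map on sections: `φ ↦ J_* φ = (id_P ×_G J) ∘ φ`. -/
def momentumMap (S : HamiltonianStructure EG G EF F) : B.Sections EF F → B.CoGaugeAlgebra :=
  pushforward S.J S.equivariant_J S.smooth_J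

variable [IsManifold (𝓡 n) ∞ M] [T2Space M] [SigmaCompactSpace M] [MeasurableSpace M]

/-- The integration pairing of `Γ(Ad P)` and `Γ(Ad^* P)`. -/
def pairing (μ : VolumeForm n M) (Y : B.GaugeAlgebra) (η : B.CoGaugeAlgebra) : ℝ :=
  ∫ m, fibrePairing Y η m ∂μ.measure

/-- The integration pairing is a well-defined, bilinear, weakly non-degenerate pairing. (The linear
structure of the fibres is `a [p, A] + b [p, A'] = [p, a A + b A']`.) -/
structure IsDualPairing (B : PrincipalBundle n EG EP G P M) (μ : VolumeForm n M) : Prop where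
  integrable : ∀ (Y : B.GaugeAlgebra) (η : B.CoGaugeAlgebra),
    MeasureTheory.Integrable (fibrePairing Y η) μ.measure
  linear_left : ∀ (a b : ℝ) (Y₁ Y₂ Y : B.GaugeAlgebra) (η : B.CoGaugeAlgebra),
    (∀ p, Y.at p = a • Y₁.at p + b • Y₂.at p) →
      pairing μ Y η = a * pairing μ Y₁ η + b * pairing μ Y₂ η
  linear_right : ∀ (a b : ℝ) (Y : B.GaugeAlgebra) (η₁ η₂ η : B.CoGaugeAlgebra),
    (∀ p, η.at p = a • η₁.at p + b • η₂.at p) →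
      pairing μ Y η = a * pairing μ Y η₁ + b * pairing μ Y η₂
  separating_left : ∀ Y₁ Y₂ : B.GaugeAlgebra,
    (∀ η : B.CoGaugeAlgebra, pairing μ Y₁ η = pairing μ Y₂ η) → Y₁ = Y₂
  separating_right : ∀ η₁ η₂ : B.CoGaugeAlgebra,
    (∀ Y : B.GaugeAlgebra, pairing μ Y η₁ = pairing μ Y η₂) → η₁ = η₂

/-- The symplectic form `Ω_φ(Z₁, Z₂) = ∫_M ω_φ(Z₁, Z₂) μ` on the space of sections, for vertical
fields `Z₁`, `Z₂` along `φ`. -/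
def symplecticForm (S : HamiltonianStructure EG G EF F) (μ : VolumeForm n M)
    (φ : B.Sections EF F) (Z₁ Z₂ : TangentVector φ) : ℝ :=
  ∫ m, fibreForm S Z₁.toSec Z₂.toSec m ∂μ.measure

/-- `𝓙` is a momentum map for the action of the gauge group on the space of sections with its
symplectic form: `𝓙` is smooth and `Y^* ⌟ Ω + d⟨Y, 𝓙⟩ = 0` for all `Y` in the gauge algebra, where
`Y^*` is a vector field on the space of sections. -/
def IsMomentumMap (S : HamiltonianStructure EG G EF F) (μ : VolumeForm n M)
    (𝓙 : B.Sections EF F → B.CoGaugeAlgebra) : Prop :=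
  IsSmoothMap 𝓙 ∧
  ∀ (Y : B.GaugeAlgebra) (φ : B.Sections EF F), ∃ Yφ : TangentVector φ,
    Yφ.toSec = generator Y φ ∧
    (∀ Z : TangentVector φ,
      MeasureTheory.Integrable (fibreForm S Yφ.toSec Z.toSec) μ.measure) ∧
    HasDifferentialAt (fun φ' => pairing μ Y (𝓙 φ')) φ fun Z => -symplecticForm S μ φ Yφ Z

end Sections

end PrincipalBundle

end GaugeMomentum

end

/-! For `p` over `m`, the map `x ↦ [p, x]` identifies the typical fibre with the fibre over `m`; it
is injective because `G` acts freely on `P`. A section is thus the same as the equivariant function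
`s.at` on `P`, and an identity between sections becomes an identity in the typical fibre.
Equivariance makes it independent of the choice of `p`.

In this picture the momentum equation on sections is that of `S`, integrated over `M`. With `A =
Y.at p` and `u = Z.at p`, `S.momentum` gives `ω(A^*, u) = -⟨A, TJ u⟩` (`fibreForm_generator`). By
the chain rule `⟨A, TJ u⟩` is the derivative of `⟨A, J(f_t)⟩` along a curve with velocity `u`
(`deriv_fibrePairing_momentumMap`). Differentiation under the integral sign
(`hasDerivAt_integral_of_contMDiff`) finishes the argument; compactness of `M` supplies the
dominating constant and the finiteness of the measure.

For the generator, a gauge curve moves `p` to `p g_t` with `g_t` smooth of velocity `Y.at p`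
(`IsGaugeCurve.exists_group_curve`). Hence `ψ_t · φ` has the coordinate `g_t · f`, whose derivative
is the fundamental vector. Weak non-degeneracy is the bump function argument
(`exists_smoothSec_integral_pos`), which needs the measure to be positive on non-empty open sets.

What remains is smoothness: coordinates of smooth sections along smooth lifts are smooth
(`SmoothInto.contMDiffOn`), given that the actions on `𝔤`, `𝔤^*` and `TF` are smooth. -/

namespace GaugeMomentum

/-! ### The measure of a volume form: finite, and positive on open sets -/

section Measure

open MeasureTheory Set

variable {n : ℕ} {M : Type*} [TopologicalSpace M] [ChartedSpace (EuclideanSpace ℝ (Fin n)) M]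

/-- The coefficient of a volume form in the chart around `x₀`. -/
noncomputable def VolumeForm.coeff (μ : VolumeForm n M) (x₀ : M)
    (y : EuclideanSpace ℝ (Fin n)) : ℝ :=
  formInChart (𝓡 n) μ.form x₀ y fun i => EuclideanSpace.single i (1 : ℝ)

theorem VolumeForm.continuousOn_coeff (μ : VolumeForm n M) (x₀ : M) :
    ContinuousOn (μ.coeff x₀) (extChartAt (𝓡 n) x₀).target := by
  have h := (μ.smooth x₀).continuousOn
  exact (continuous_eval_const _).comp_continuousOn h

/-- The derivative of the inverse chart is invertible, so it carries the standard basis to a basis,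
and a non-zero form of top degree does not vanish on a basis. -/
theorem VolumeForm.coeff_ne_zero [IsManifold (𝓡 n) ∞ M] (μ : VolumeForm n M) (x₀ : M)
    {y : EuclideanSpace ℝ (Fin n)} (hy : y ∈ (extChartAt (𝓡 n) x₀).target) :
    μ.coeff x₀ y ≠ 0 := by
  have : IsManifold (𝓡 n) 1 M := IsManifold.of_le (n := ∞) (by simp)
  have hinv := isInvertible_mfderivWithin_extChartAt_symm hy
  simp only [ModelWithCorners.range_eq_univ, mfderivWithin_univ] at hinv
  obtain ⟨L, hL⟩ := hinv
  let b := (EuclideanSpace.basisFun (Fin n) ℝ).toBasis.map L.toLinearEquiv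
  have hne : (μ.form ((extChartAt (𝓡 n) x₀).symm y)).toAlternatingMap ≠ 0 := fun h =>
    μ.form_ne_zero _ (ContinuousAlternatingMap.toAlternatingMap_injective h)
  have key := (AlternatingMap.map_basis_ne_zero_iff b _).2 hne
  convert key using 1
  have h2 : (fun i => (mfderiv 𝓘(ℝ, EuclideanSpace ℝ (Fin n)) (𝓡 n)
      (extChartAt (𝓡 n) x₀).symm y) (EuclideanSpace.single i (1 : ℝ))) = ⇑b := by
    funext i
    have he : (EuclideanSpace.basisFun (Fin n) ℝ).toBasis i = EuclideanSpace.single i 1 := by simp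
    have hb : b i = L (EuclideanSpace.single i 1) :=
      ((EuclideanSpace.basisFun (Fin n) ℝ).toBasis.map_apply L.toLinearEquiv i).trans
        (congrArg L he)
    rw [← hL, hb]
    rfl
  exact congrArg (μ.form ((extChartAt (𝓡 n) x₀).symm y)) h2

theorem VolumeForm.aemeasurable_coeff (μ : VolumeForm n M) (x₀ : M) :
    AEMeasurable (fun y => ENNReal.ofReal |μ.coeff x₀ y|)
      (volume.restrict (extChartAt (𝓡 n) x₀).target) :=
  ((μ.continuousOn_coeff x₀).abs.aemeasurable
    (isOpen_extChartAt_target x₀).measurableSet).ennreal_ofReal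

theorem tsupport_chartPartition_subset [IsManifold (𝓡 n) ∞ M] [T2Space M] [CompactSpace M]
    (x₀ : M) :
    tsupport (chartPartition n M x₀) ⊆ (extChartAt (𝓡 n) x₀).source := by
  rw [extChartAt_source]
  exact (SmoothPartitionOfUnity.exists_isSubordinate_chartAt_source (𝓡 n) M).choose_spec x₀

variable [MeasurableSpace M] [BorelSpace M]

theorem aemeasurable_extChartAt_symm (x₀ : M) :
    AEMeasurable (extChartAt (𝓡 n) x₀).symm (volume.restrict (extChartAt (𝓡 n) x₀).target) :=
  (continuousOn_extChartAt_symm x₀).aemeasurable (isOpen_extChartAt_target x₀).measurableSet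

theorem VolumeForm.lintegral_chartMeasure (μ : VolumeForm n M) (x₀ : M) {f : M → ENNReal}
    (hf : Measurable f) :
    ∫⁻ m, f m ∂μ.chartMeasure x₀ = ∫⁻ y in (extChartAt (𝓡 n) x₀).target,
      ENNReal.ofReal |μ.coeff x₀ y| * f ((extChartAt (𝓡 n) x₀).symm y) := by
  have h1 := aemeasurable_extChartAt_symm (n := n) x₀
  have h2 := μ.aemeasurable_coeff x₀
  rw [VolumeForm.chartMeasure, lintegral_map' hf.aemeasurable
    (h1.mono_ac (withDensity_absolutelyContinuous _ _))]
  exact lintegral_withDensity_eq_lintegral_mul₀ h2 (hf.comp_aemeasurable h1)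

variable [IsManifold (𝓡 n) ∞ M] [T2Space M] [CompactSpace M]

theorem measurable_chartPartition (x₀ : M) :
    Measurable fun m => ENNReal.ofReal (chartPartition n M x₀ m) :=
  (chartPartition n M x₀).contMDiff.continuous.measurable.ennreal_ofReal

/-- In coordinates the integrand lives on the compact image `K` of the support of the partition
function. There the coefficient is bounded, and `K` has finite Lebesgue measure. -/
theorem VolumeForm.lintegral_chartPartition_lt_top (μ : VolumeForm n M) (x₀ : M) :
    ∫⁻ m, ENNReal.ofReal (chartPartition n M x₀ m) ∂μ.chartMeasure x₀ < ⊤ := by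
  rw [μ.lintegral_chartMeasure x₀ (measurable_chartPartition x₀)]
  set e := extChartAt (𝓡 n) x₀ with he
  set ρ := chartPartition n M x₀ with hρ
  let K : Set (EuclideanSpace ℝ (Fin n)) := e '' tsupport ρ
  have hK : IsCompact K := (isClosed_tsupport ρ).isCompact.image_of_continuousOn
    ((continuousOn_extChartAt x₀).mono (tsupport_chartPartition_subset x₀))
  have hKt : K ⊆ e.target := by
    rintro _ ⟨m, hm, rfl⟩
    exact e.map_source (tsupport_chartPartition_subset x₀ hm)
  obtain ⟨C, hC⟩ := hK.exists_bound_of_continuousOn ((μ.continuousOn_coeff x₀).mono hKt)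
  have hle : ∀ y ∈ e.target, ENNReal.ofReal |μ.coeff x₀ y| * ENNReal.ofReal (ρ (e.symm y)) ≤
      K.indicator (fun _ => ENNReal.ofReal C) y := by
    intro y hy
    by_cases hyK : y ∈ K
    · rw [indicator_of_mem hyK, ← mul_one (ENNReal.ofReal C)]
      gcongr
      · exact hC y hyK
      · rw [← ENNReal.ofReal_one]
        exact ENNReal.ofReal_le_ofReal ((chartPartition n M).le_one x₀ _)
    · have : ρ (e.symm y) = 0 := by
        by_contra h
        exact hyK ⟨e.symm y, subset_tsupport _ h, e.right_inv hy⟩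
      simp [this]
  calc ∫⁻ y in e.target, ENNReal.ofReal |μ.coeff x₀ y| * ENNReal.ofReal (ρ (e.symm y))
      ≤ ∫⁻ y in e.target, K.indicator (fun _ => ENNReal.ofReal C) y :=
        setLIntegral_mono' (isOpen_extChartAt_target x₀).measurableSet hle
    _ ≤ ∫⁻ y, K.indicator (fun _ => ENNReal.ofReal C) y := setLIntegral_le_lintegral _ _
    _ = ENNReal.ofReal C * volume K := lintegral_indicator_const hK.measurableSet _
    _ < ⊤ := ENNReal.mul_lt_top ENNReal.ofReal_lt_top hK.measure_lt_top

instance VolumeForm.isFiniteMeasure_measure (μ : VolumeForm n M) : IsFiniteMeasure μ.measure := by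
  constructor
  rw [VolumeForm.measure, Measure.sum_apply _ MeasurableSet.univ]
  -- Local finiteness and compactness leave only finitely many non-zero summands.
  have hfin : {x₀ : M | (Function.support (chartPartition n M x₀)).Nonempty}.Finite :=
    (chartPartition n M).locallyFinite.finite_nonempty_of_compact
  rw [tsum_eq_sum (s := hfin.toFinset)]
  · refine ENNReal.sum_lt_top.2 fun x₀ _ => ?_
    rw [withDensity_apply _ MeasurableSet.univ, Measure.restrict_univ]
    exact μ.lintegral_chartPartition_lt_top x₀
  · intro x₀ hx
    have h0 : ∀ m, chartPartition n M x₀ m = 0 := by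
      intro m
      by_contra h
      exact hx (hfin.mem_toFinset.2 ⟨m, h⟩)
    simp [h0]

/-- Some partition function is non-zero at a given point of `U`. In that chart the density is
strictly positive on a non-empty open set of coordinates, which Lebesgue measure does not neglect.
-/
instance VolumeForm.isOpenPosMeasure_measure (μ : VolumeForm n M) :
    μ.measure.IsOpenPosMeasure := by
  constructor
  rintro U hU ⟨m, hm⟩ h0
  obtain ⟨x₀, hx₀⟩ : ∃ x₀, chartPartition n M x₀ m ≠ 0 := by
    by_contra! h
    have := (chartPartition n M).sum_eq_one (mem_univ m)
    simp [h] at this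
  rw [VolumeForm.measure, Measure.sum_apply _ hU.measurableSet, ENNReal.tsum_eq_zero] at h0
  have h := h0 x₀
  have hmeas := measurable_chartPartition (n := n) x₀
  rw [withDensity_apply _ hU.measurableSet, ← lintegral_indicator hU.measurableSet,
    μ.lintegral_chartMeasure x₀ (hmeas.indicator hU.measurableSet)] at h
  set e := extChartAt (𝓡 n) x₀ with he
  have ht : MeasurableSet e.target := (isOpen_extChartAt_target x₀).measurableSet
  replace h := (lintegral_eq_zero_iff' ((μ.aemeasurable_coeff x₀).mul
    ((hmeas.indicator hU.measurableSet).comp_aemeasurable (aemeasurable_extChartAt_symm x₀)))).1 h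
  have hae := (ae_restrict_iff' ht).1 h
  let W : Set M := U ∩ Function.support (chartPartition n M x₀)
  have hW : IsOpen W :=
    hU.inter (chartPartition n M x₀).contMDiff.continuous.isOpen_support
  let V : Set (EuclideanSpace ℝ (Fin n)) := e.target ∩ e.symm ⁻¹' W
  have hV : IsOpen V := (continuousOn_extChartAt_symm x₀).isOpen_inter_preimage
    (isOpen_extChartAt_target x₀) hW
  have hms : m ∈ e.source := tsupport_chartPartition_subset x₀ (subset_tsupport _ hx₀)
  have hVne : V.Nonempty :=
    ⟨e m, e.map_source hms, by
      change e.symm (e m) ∈ W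
      rw [e.left_inv hms]; exact ⟨hm, hx₀⟩⟩
  refine (hV.measure_pos volume hVne).ne' (measure_mono_null ?_ hae)
  rintro y ⟨hyt, hyU, hyρ⟩ hy
  have hpos : 0 < chartPartition n M x₀ (e.symm y) :=
    lt_of_le_of_ne ((chartPartition n M).nonneg x₀ _) (Ne.symm hyρ)
  have h1 : ENNReal.ofReal |μ.coeff x₀ y| * U.indicator
      (fun m => ENNReal.ofReal (chartPartition n M x₀ m)) (e.symm y) = 0 := hy hyt
  rw [indicator_of_mem hyU, mul_eq_zero, ENNReal.ofReal_eq_zero, ENNReal.ofReal_eq_zero] at h1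
  exact h1.elim (not_le.2 (abs_pos.2 (μ.coeff_ne_zero x₀ hyt))) (not_le.2 hpos)

theorem VolumeForm.integrable_of_continuous (μ : VolumeForm n M) {f : M → ℝ} (hf : Continuous f) :
    Integrable f μ.measure :=
  hf.integrable_of_hasCompactSupport (HasCompactSupport.of_compactSpace f)

end Measure

end GaugeMomentum

/-! ### Fibre coordinates of sections of associated bundles -/

namespace GaugeMomentum

/-- A smooth left action of `G` on the manifold `X`, given by a map `G → X → X`. -/
structure IsSmoothAction {EG G EX HX X : Type*} [NormedAddCommGroup EG] [NormedSpace ℝ EG]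
    [Group G] [TopologicalSpace G] [ChartedSpace EG G]
    [NormedAddCommGroup EX] [NormedSpace ℝ EX] [TopologicalSpace HX]
    (IX : ModelWithCorners ℝ EX HX) [TopologicalSpace X] [ChartedSpace HX X]
    (ρ : G → X → X) : Prop where
  one : ∀ x, ρ 1 x = x
  mul : ∀ g h x, ρ (g * h) x = ρ g (ρ h x)
  smooth : ContMDiff (𝓘(ℝ, EG).prod IX) IX ∞ fun z : G × X => ρ z.1 z.2

theorem IsSmoothAction.contMDiff_apply {EG G EX HX X : Type*} [NormedAddCommGroup EG]
    [NormedSpace ℝ EG] [Group G] [TopologicalSpace G] [ChartedSpace EG G]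
    [NormedAddCommGroup EX] [NormedSpace ℝ EX] [TopologicalSpace HX]
    {IX : ModelWithCorners ℝ EX HX} [TopologicalSpace X] [ChartedSpace HX X]
    {ρ : G → X → X} (hρ : IsSmoothAction (EG := EG) IX ρ) (g : G) : ContMDiff IX IX ∞ (ρ g) :=
  hρ.smooth.comp (contMDiff_const.prodMk contMDiff_id)

namespace PrincipalBundle

variable {n : ℕ} {EG EP G P M : Type*}
  [NormedAddCommGroup EG] [NormedSpace ℝ EG] [NormedAddCommGroup EP] [NormedSpace ℝ EP]
  [Group G] [TopologicalSpace G] [ChartedSpace EG G]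
  [TopologicalSpace P] [ChartedSpace EP P] [MulAction Gᵐᵒᵖ P]
  [TopologicalSpace M] [ChartedSpace (EuclideanSpace ℝ (Fin n)) M]
  (B : PrincipalBundle n EG EP G P M)

theorem exists_local_section (m : M) : ∃ (U : Set M) (a : M → P), IsOpen U ∧ m ∈ U ∧
    ContMDiffOn (𝓡 n) 𝓘(ℝ, EP) ∞ a U ∧ ∀ z ∈ U, B.proj (a z) = z := by
  obtain ⟨U, e, hU, hm, hs, ht, -, he, h⟩ := B.locally_trivial m
  have hmem : ∀ z ∈ U, ((z, 1) : M × G) ∈ e.target := fun z hz => by rw [ht]; exact ⟨hz, trivial⟩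
  refine ⟨U, fun z => e.symm (z, 1), hU, hm, ?_, fun z hz => ?_⟩
  · exact he.comp (contMDiff_id.prodMk contMDiff_const).contMDiffOn hmem
  · have := (h _ (e.map_target (hmem z hz))).1
    rw [e.right_inv (hmem z hz)] at this
    exact this.symm

/-- Near a point, any two points of `P` in the same fibre differ by a smooth function. -/
theorem exists_smooth_division [LieGroup 𝓘(ℝ, EG) ∞ G] {EN HN N : Type*} [NormedAddCommGroup EN]
    [NormedSpace ℝ EN] [TopologicalSpace HN] {IN : ModelWithCorners ℝ EN HN} [TopologicalSpace N]
    [ChartedSpace HN N] {y : N} {U : Set N} (hU : U ∈ 𝓝 y) {a b : N → P}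
    (ha : ContMDiffOn IN 𝓘(ℝ, EP) ∞ a U) (hb : ContMDiffOn IN 𝓘(ℝ, EP) ∞ b U)
    (hab : ∀ z ∈ U, B.proj (a z) = B.proj (b z)) :
    ∃ V ∈ 𝓝 y, V ⊆ U ∧ ∃ g : N → G, ContMDiffOn IN 𝓘(ℝ, EG) ∞ g V ∧
      ∀ z ∈ V, b z = a z <• g z := by
  obtain ⟨W, e, hW, hm, hs, ht, he, -, h⟩ := B.locally_trivial (B.proj (a y))
  have hcont : ContinuousAt (fun z => B.proj (a z)) y :=
    B.smooth_proj.continuous.continuousAt.comp (ha.continuousOn.continuousAt hU)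
  have haV : ∀ z ∈ U ∩ (fun z => B.proj (a z)) ⁻¹' W, a z ∈ e.source := fun z hz => by
    rw [hs]; exact hz.2
  have hbV : ∀ z ∈ U ∩ (fun z => B.proj (a z)) ⁻¹' W, b z ∈ e.source := fun z hz => by
    rw [hs]; change B.proj (b z) ∈ W; rw [← hab z hz.1]; exact hz.2
  -- In a trivialization the action is right multiplication on the `G`-component, so the quotient is
  -- `(e a).2⁻¹ * (e b).2`.
  refine ⟨U ∩ (fun z => B.proj (a z)) ⁻¹' W,
    Filter.inter_mem hU (hcont (hW.mem_nhds hm)), Set.inter_subset_left,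
    fun z => (e (a z)).2⁻¹ * (e (b z)).2, ?_, fun z hz => ?_⟩
  · have h1 := contMDiff_snd.comp_contMDiffOn (he.comp (ha.mono Set.inter_subset_left) haV)
    have h2 := contMDiff_snd.comp_contMDiffOn (he.comp (hb.mono Set.inter_subset_left) hbV)
    exact h1.inv.mul h2
  · have hg := (h _ (haV z hz)).2 ((e (a z)).2⁻¹ * (e (b z)).2)
    have hmem : a z <• ((e (a z)).2⁻¹ * (e (b z)).2) ∈ e.source := by
      rw [hs]
      change B.proj _ ∈ W
      rw [B.proj_smul]
      exact hz.2
    refine e.injOn (hbV z hz) hmem ?_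
    rw [hg, mul_inv_cancel_left, (h _ (haV z hz)).1, hab z hz.1, ← (h _ (hbV z hz)).1]

theorem cls_smul {X : Type*} (ρ : G → X → X) (p : P) (g : G) (x : X) :
    B.cls ρ (p <• g) (ρ g⁻¹ x) = B.cls ρ p x :=
  (Quot.sound ⟨g, rfl⟩).symm

section Assoc

variable {EX HX X : Type*} [NormedAddCommGroup EX] [NormedSpace ℝ EX] [TopologicalSpace HX]
  {IX : ModelWithCorners ℝ EX HX} [TopologicalSpace X] [ChartedSpace HX X] {ρ : G → X → X}

theorem cls_smul_left (hρ : IsSmoothAction (EG := EG) IX ρ) (p : P) (g : G) (x : X) :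
    B.cls ρ (p <• g) x = B.cls ρ p (ρ g x) := by
  rw [← B.cls_smul ρ p g (ρ g x), ← hρ.mul, inv_mul_cancel, hρ.one]

/-- The group laws make the defining relation an equivalence relation already, so equal classes are
related by a single `g`; as both have first component `p`, freeness forces `g = 1`. -/
theorem cls_injective (hρ : IsSmoothAction (EG := EG) IX ρ) (p : P) :
    Function.Injective (B.cls ρ p) := by
  have hequiv : Equivalence fun a b : P × X => ∃ g : G, b = (a.1 <• g, ρ g⁻¹ a.2) := by
    refine ⟨fun a => ⟨1, by simp [hρ.one]⟩, ?_, ?_⟩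
    · rintro a b ⟨g, rfl⟩
      exact ⟨g⁻¹, by simp [← hρ.mul, hρ.one]⟩
    · rintro a b c ⟨g, rfl⟩ ⟨h, rfl⟩
      exact ⟨g * h, by simp [hρ.mul, mul_smul]⟩
  intro x y hxy
  obtain ⟨g, hg⟩ := hequiv.quot_mk_eq_iff _ _ |>.1 hxy
  obtain ⟨h1, h2⟩ := Prod.mk.inj hg
  rw [h2, B.free p g h1.symm, inv_one, hρ.one]

variable {B}

/-- Frees `Sec.at` from the choice in its definition; every computation of a coordinate below goes
through this. -/
theorem Sec.at_eq (hρ : IsSmoothAction (EG := EG) IX ρ) (s : B.Sec ρ) {p : P} {x : X}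
    (h : s.toFun (B.proj p) = B.cls ρ p x) : s.at p = x :=
  B.cls_injective hρ p ((s.cls_at p).trans h)

theorem Sec.at_smul (hρ : IsSmoothAction (EG := EG) IX ρ) (s : B.Sec ρ) (p : P) (g : G) :
    s.at (p <• g) = ρ g⁻¹ (s.at p) :=
  s.at_eq hρ (by rw [B.proj_smul, B.cls_smul, s.cls_at])

variable {EN HN N : Type*} [NormedAddCommGroup EN] [NormedSpace ℝ EN] [TopologicalSpace HN]
  {IN : ModelWithCorners ℝ EN HN} [TopologicalSpace N] [ChartedSpace HN N]

theorem SmoothInto.comp {EN' HN' N' : Type*} [NormedAddCommGroup EN'] [NormedSpace ℝ EN']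
    [TopologicalSpace HN'] {IN' : ModelWithCorners ℝ EN' HN'} [TopologicalSpace N']
    [ChartedSpace HN' N'] {s : N → B.Assoc ρ} (hs : B.SmoothInto IX IN s) {f : N' → N}
    (hf : ContMDiff IN' IN ∞ f) : B.SmoothInto IX IN' (s ∘ f) := by
  intro y
  obtain ⟨U, hU, a, x, ha, hx, h⟩ := hs (f y)
  exact ⟨f ⁻¹' U, hf.continuous.continuousAt hU, a ∘ f, x ∘ f,
    ha.comp hf.contMDiffOn subset_rfl, hx.comp hf.contMDiffOn subset_rfl, fun z hz => h _ hz⟩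

/-- The coordinate of a smooth map into `P ×_G X` with respect to a smooth map into `P`
is smooth. -/
theorem SmoothInto.contMDiffOn [LieGroup 𝓘(ℝ, EG) ∞ G] (hρ : IsSmoothAction (EG := EG) IX ρ)
    {s : N → B.Assoc ρ} (hs : B.SmoothInto IX IN s) {W : Set N} (hW : IsOpen W) {a : N → P}
    {x : N → X} (ha : ContMDiffOn IN 𝓘(ℝ, EP) ∞ a W) (h : ∀ z ∈ W, s z = B.cls ρ (a z) (x z)) :
    ContMDiffOn IN IX ∞ x W := by
  intro y hy
  obtain ⟨U, hU, b, x', hb, hx', h'⟩ := hs y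
  have hUW : U ∩ W ∈ 𝓝 y := Filter.inter_mem hU (hW.mem_nhds hy)
  -- The given lift `a` and the lift `b` provided by smoothness of `s` differ by a smooth `g`; hence
  -- `x = g · x'` with `x'` smooth.
  obtain ⟨V, hV, hVU, g, hg, hgab⟩ := B.exists_smooth_division hUW
    (ha.mono Set.inter_subset_right) (hb.mono Set.inter_subset_left) fun z hz =>
      congrArg B.assocProj ((h z hz.2).symm.trans (h' z hz.1))
  have hx : ∀ z ∈ V, x z = ρ (g z) (x' z) := fun z hz => by
    apply B.cls_injective hρ (a z)
    rw [← h z (hVU hz).2, h' z (hVU hz).1, hgab z hz, B.cls_smul_left hρ]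
  have hsm : ContMDiffOn IN IX ∞ (fun z => ρ (g z) (x' z)) V :=
    hρ.smooth.comp_contMDiffOn (hg.prodMk (hx'.mono fun z hz => (hVU hz).1))
  exact ((hsm.congr hx).contMDiffAt hV).contMDiffWithinAt

theorem SmoothSec.contMDiffOn_at [LieGroup 𝓘(ℝ, EG) ∞ G] (hρ : IsSmoothAction (EG := EG) IX ρ)
    (s : B.SmoothSec IX ρ) {U : Set M} (hU : IsOpen U) {a : M → P}
    (ha : ContMDiffOn (𝓡 n) 𝓘(ℝ, EP) ∞ a U) (hp : ∀ z ∈ U, B.proj (a z) = z) :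
    ContMDiffOn (𝓡 n) IX ∞ (fun z => s.at (a z)) U :=
  s.smooth.contMDiffOn hρ hU ha fun z hz => by
    rw [s.cls_at, hp z hz]

theorem IsSmoothFamily.contMDiffOn_at [LieGroup 𝓘(ℝ, EG) ∞ G]
    (hρ : IsSmoothAction (EG := EG) IX ρ) {c : N → B.SmoothSec IX ρ} (hc : IsSmoothFamily IN c)
    {U : Set M} (hU : IsOpen U) {a : M → P}
    (ha : ContMDiffOn (𝓡 n) 𝓘(ℝ, EP) ∞ a U) (hp : ∀ z ∈ U, B.proj (a z) = z) :
    ContMDiffOn (IN.prod (𝓡 n)) IX ∞ (fun z : N × M => (c z.1).at (a z.2)) (Prod.snd ⁻¹' U) :=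
  SmoothInto.contMDiffOn hρ hc (hU.preimage continuous_snd)
    (ha.comp contMDiff_snd.contMDiffOn subset_rfl) fun z hz => by
      rw [Function.comp_apply, Sec.cls_at, hp z.2 hz]

/-- On the slice of the family over the single point `B.proj p`, the constant map `p` serves as the
smooth lift. -/
theorem IsSmoothFamily.contMDiff_at [LieGroup 𝓘(ℝ, EG) ∞ G]
    (hρ : IsSmoothAction (EG := EG) IX ρ) {c : N → B.SmoothSec IX ρ} (hc : IsSmoothFamily IN c)
    (p : P) : ContMDiff IN IX ∞ fun y => (c y).at p := by
  rw [← contMDiffOn_univ]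
  exact (SmoothInto.comp hc (contMDiff_id.prodMk contMDiff_const)).contMDiffOn hρ isOpen_univ
    (a := fun _ => p) contMDiffOn_const fun y _ => ((c y).cls_at p).symm

theorem IsSmoothFamily.pushforward {X' EX' HX' : Type*} [NormedAddCommGroup EX']
    [NormedSpace ℝ EX'] [TopologicalSpace HX'] {IX' : ModelWithCorners ℝ EX' HX'}
    [TopologicalSpace X'] [ChartedSpace HX' X'] {ρ' : G → X' → X'} {j : X → X'}
    (hj : ∀ g x, j (ρ g x) = ρ' g (j x)) (hsm : ContMDiff IX IX' ∞ j)
    {c : N → B.SmoothSec IX ρ} (hc : IsSmoothFamily IN c) :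
    IsSmoothFamily IN fun y => PrincipalBundle.pushforward j hj hsm (c y) := by
  intro y
  obtain ⟨U, hU, a, x, ha, hx, h⟩ := hc y
  refine ⟨U, hU, a, fun z => j (x z), ha, hsm.comp_contMDiffOn hx, fun z hz => ?_⟩
  change B.assocMap j hj ((c z.1).toFun z.2) = _
  rw [show (c z.1).toFun z.2 = _ from h z hz]
  rfl

theorem pushforward_at {X' EX' HX' : Type*} [NormedAddCommGroup EX']
    [NormedSpace ℝ EX'] [TopologicalSpace HX'] {IX' : ModelWithCorners ℝ EX' HX'}
    [TopologicalSpace X'] [ChartedSpace HX' X'] {ρ' : G → X' → X'} {j : X → X'}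
    (hρ' : IsSmoothAction (EG := EG) IX' ρ')
    (hj : ∀ g x, j (ρ g x) = ρ' g (j x)) (hsm : ContMDiff IX IX' ∞ j) (s : B.SmoothSec IX ρ)
    (p : P) : (PrincipalBundle.pushforward j hj hsm s).at p = j (s.at p) := by
  apply Sec.at_eq hρ'
  change B.assocMap j hj (s.toFun (B.proj p)) = _
  rw [← s.cls_at]
  rfl

end Assoc

section Linear

variable {EX : Type*} [NormedAddCommGroup EX] [NormedSpace ℝ EX] {ρ : G → EX → EX}

/-- A constant vector in a local trivialization, multiplied with a cut-off function, extends by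
zero to a global smooth section. -/
theorem exists_smoothSec_of_cutoff (hρ : IsSmoothAction (EG := EG) 𝓘(ℝ, EX) ρ)
    (hρ0 : ∀ g, ρ g 0 = 0) {U : Set M} (hU : IsOpen U) {a : M → P}
    (ha : ContMDiffOn (𝓡 n) 𝓘(ℝ, EP) ∞ a U) (hp : ∀ z ∈ U, B.proj (a z) = z) {χ : M → ℝ}
    (hχ : ContMDiff (𝓡 n) 𝓘(ℝ, ℝ) ∞ χ) (hsupp : tsupport χ ⊆ U) (v : EX) :
    ∃ s : B.SmoothSec 𝓘(ℝ, EX) ρ, (∀ m ∈ U, s.at (a m) = χ m • v) ∧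
      ∀ p, B.proj p ∉ U → s.at p = 0 := by
  classical
  -- The zero section does not depend on representatives because the action fixes `0`.
  have hzero : ∀ p q : P, B.proj p = B.proj q → B.cls ρ p 0 = B.cls ρ q 0 := fun p q hpq => by
    obtain ⟨g, rfl⟩ := (B.proj_eq_iff p q).1 hpq
    rw [B.cls_smul_left hρ, hρ0]
  let s : B.SmoothSec 𝓘(ℝ, EX) ρ :=
    { toFun := fun m => if m ∈ U then B.cls ρ (a m) (χ m • v) else B.cls ρ (B.point m) 0
      proj_toFun := fun m => by
        by_cases hm : m ∈ U
        · rw [if_pos hm]; exact hp m hm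
        · rw [if_neg hm]; exact B.proj_point m
      smooth := fun y => by
        by_cases hy : y ∈ U
        · exact ⟨U, hU.mem_nhds hy, a, fun z => χ z • v, ha,
            (hχ.smul contMDiff_const).contMDiffOn, fun z hz => if_pos hz⟩
        -- Away from the support of `χ` both branches give the zero section, which is smooth by
        -- means of any local lift `b`.
        · obtain ⟨V, b, hV, hyV, hb, hpb⟩ := B.exists_local_section y
          have hyχ : y ∈ (tsupport χ)ᶜ := fun h => hy (hsupp h)
          refine ⟨V ∩ (tsupport χ)ᶜ, Filter.inter_mem (hV.mem_nhds hyV)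
            ((isClosed_tsupport χ).isOpen_compl.mem_nhds hyχ), b, fun _ => 0,
            hb.mono Set.inter_subset_left, contMDiffOn_const, fun z hz => ?_⟩
          have hz0 : χ z = 0 := image_eq_zero_of_notMem_tsupport hz.2
          beta_reduce
          by_cases hzU : z ∈ U
          · rw [if_pos hzU, hz0, zero_smul]
            exact hzero _ _ ((hp z hzU).trans (hpb z hz.1).symm)
          · rw [if_neg hzU]
            exact hzero _ _ ((B.proj_point z).trans (hpb z hz.1).symm) }
  refine ⟨s, fun m hm => Sec.at_eq hρ _ ?_, fun p hpU => Sec.at_eq hρ _ ?_⟩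
  · rw [hp m hm]; exact if_pos hm
  · exact (if_neg hpU).trans (hzero _ _ (B.proj_point _))

end Linear

end PrincipalBundle

end GaugeMomentum

/-! ### Partial tangent maps, and smoothness of the induced actions -/

namespace GaugeMomentum

section Tangent

variable {E H M E' H' M' E'' H'' M'' : Type*}
  [NormedAddCommGroup E] [NormedSpace ℝ E] [TopologicalSpace H] {I : ModelWithCorners ℝ E H}
  [TopologicalSpace M] [ChartedSpace H M]
  [NormedAddCommGroup E'] [NormedSpace ℝ E'] [TopologicalSpace H'] {I' : ModelWithCorners ℝ E' H'}
  [TopologicalSpace M'] [ChartedSpace H' M']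
  [NormedAddCommGroup E''] [NormedSpace ℝ E''] [TopologicalSpace H'']
  {I'' : ModelWithCorners ℝ E'' H''} [TopologicalSpace M''] [ChartedSpace H'' M'']

theorem tangentBundle_mk_injective {x : M} {v w : E}
    (h : (⟨x, v⟩ : TangentBundle I M) = ⟨x, w⟩) : v = w := by
  cases h
  rfl

/-- The partial tangent map in the second variable. -/
theorem tangentMap_prod_zero_left {f : M × M' → M''} (x : M) (v : TangentBundle I' M')
    (hf : MDifferentiableAt (I.prod I') I'' f (x, v.proj)) :
    tangentMap (I.prod I') I'' f ((equivTangentBundleProd I M I' M').symm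
      (Bundle.zeroSection E (TangentSpace I) x, v)) = tangentMap I' I'' (fun y => f (x, y)) v := by
  have h := tangentMap_comp_at (I := I') (I' := I.prod I') (I'' := I'') (g := f)
    (f := fun y => (x, y)) v hf (mdifferentiableAt_const.prodMk mdifferentiableAt_id)
  refine (Eq.trans h (congrArg _ ?_)).symm
  simp only [tangentMap, mfderiv_prod_right]
  rfl

/-- The partial tangent map in the first variable. -/
theorem tangentMap_prod_zero_right {f : M × M' → M''} (v : TangentBundle I M) (y : M')
    (hf : MDifferentiableAt (I.prod I') I'' f (v.proj, y)) :
    tangentMap (I.prod I') I'' f ((equivTangentBundleProd I M I' M').symm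
      (v, Bundle.zeroSection E' (TangentSpace I') y)) = tangentMap I I'' (fun x => f (x, y)) v := by
  have h := tangentMap_comp_at (I := I) (I' := I.prod I') (I'' := I'') (g := f)
    (f := fun x => (x, y)) v hf (mdifferentiableAt_id.prodMk mdifferentiableAt_const)
  refine (Eq.trans h (congrArg _ ?_)).symm
  simp only [tangentMap, mfderiv_prod_left]
  rfl

theorem contMDiff_tangentMap_infty [IsManifold I ∞ M] [IsManifold I' ∞ M'] {f : M → M'}
    (hf : ContMDiff I I' ∞ f) : ContMDiff I.tangent I'.tangent ∞ (tangentMap I I' f) := by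
  have : IsManifold I 1 M := IsManifold.of_le (n := ∞) (by simp)
  have : IsManifold I' 1 M' := IsManifold.of_le (n := ∞) (by simp)
  exact hf.contMDiff_tangentMap (by simp)

/-- The derivative of a smooth function with values in a vector space is continuous on the tangent
bundle. -/
theorem continuous_mfderiv_apply [IsManifold I ∞ M] {f : M → E'} (hf : ContMDiff I 𝓘(ℝ, E') ∞ f) :
    Continuous fun v : TangentBundle I M =>
      (show E' from mfderiv I 𝓘(ℝ, E') f v.proj v.snd) :=
  (continuous_snd.comp (tangentBundleModelSpaceHomeomorph 𝓘(ℝ, E')).continuous).comp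
    (contMDiff_tangentMap_infty hf).continuous

/-- The inclusion of a tangent space into the tangent bundle is smooth. -/
theorem contMDiff_tangentBundle_mk [IsManifold I ∞ M] (x : M) :
    ContMDiff 𝓘(ℝ, E) I.tangent ∞ fun v : E => (⟨x, v⟩ : TangentBundle I M) := by
  have : IsManifold I 1 M := IsManifold.of_le (n := ∞) (by simp)
  intro v
  rw [Bundle.contMDiffAt_totalSpace]
  refine ⟨contMDiffAt_const, ?_⟩
  -- The base point is fixed, so in the trivialization the inclusion is one continuous linear map.
  let L : E →L[ℝ] E := (trivializationAt E (TangentSpace I) x).continuousLinearMapAt ℝ x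
  refine (L.contMDiff (n := ∞) (x := v)).congr_of_eventuallyEq
    (Filter.Eventually.of_forall fun w => ?_)
  exact ((trivializationAt E (TangentSpace I) x).continuousLinearMapAt_apply_of_mem (R := ℝ)
    (FiberBundle.mem_baseSet_trivializationAt' x) w).symm

end Tangent

section Actions

variable {EG : Type*} [NormedAddCommGroup EG] [NormedSpace ℝ EG]
  {G : Type*} [Group G] [TopologicalSpace G] [ChartedSpace EG G]

theorem Ad_one : Ad (1 : G) = ContinuousLinearMap.id ℝ EG := by
  have h : (fun x : G => 1 * x * 1⁻¹) = id := by
    funext x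
    simp
  rw [Ad, h]
  exact mfderiv_id

/-- The points `g * 1 * g⁻¹` and `1` are equal but not definitionally so. Stated in the tangent
bundle, the identity can be composed with other tangent maps without casts. -/
theorem tangentMap_conj (g : G) (A : EG) :
    tangentMap 𝓘(ℝ, EG) 𝓘(ℝ, EG) (fun x : G => g * x * g⁻¹) ⟨1, A⟩ = ⟨1, (Ad g A : EG)⟩ := by
  have h : ∀ (x : G) (v : EG), x = 1 → (⟨x, v⟩ : TangentBundle 𝓘(ℝ, EG) G) = ⟨1, v⟩ := by
    rintro x v rfl
    rfl
  exact h _ _ (by simp : g * 1 * g⁻¹ = 1)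

variable {EF : Type*} [NormedAddCommGroup EF] [NormedSpace ℝ EF]
  {F : Type*} [TopologicalSpace F] [ChartedSpace EF F] [MulAction G F]

theorem tangentMap_smul_right (A : EG) (f : F) :
    tangentMap 𝓘(ℝ, EG) 𝓘(ℝ, EF) (fun g : G => g • f) ⟨1, A⟩ = ⟨f, fundamentalVector G A f⟩ := by
  have h : ∀ (x : F) (v : EF), x = f → (⟨x, v⟩ : TangentBundle 𝓘(ℝ, EF) F) = ⟨f, v⟩ := by
    rintro x v rfl
    rfl
  exact h _ _ (one_smul G f)

variable [ContMDiffSMul 𝓘(ℝ, EG) 𝓘(ℝ, EF) ∞ G F]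

theorem isSmoothAction_leftAction :
    IsSmoothAction (EG := EG) 𝓘(ℝ, EF) (leftAction : G → F → F) where
  one := one_smul G
  mul := mul_smul
  smooth := contMDiff_smul

theorem contMDiff_smul_right (f : F) : ContMDiff 𝓘(ℝ, EG) 𝓘(ℝ, EF) ∞ fun g : G => g • f :=
  contMDiff_smul.comp (contMDiff_id.prodMk contMDiff_const)

variable [LieGroup 𝓘(ℝ, EG) ∞ G]

theorem contMDiff_conj (g : G) :
    ContMDiff 𝓘(ℝ, EG) 𝓘(ℝ, EG) ∞ fun x : G => g * x * g⁻¹ :=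
  (contMDiff_const.mul contMDiff_id).mul contMDiff_const

/-- Functoriality of the tangent map, since conjugation by `g * h` is a composite of conjugations.
-/
theorem Ad_mul_apply (g h : G) (A : EG) : Ad (g * h) A = Ad g (Ad h A) := by
  apply tangentBundle_mk_injective (I := 𝓘(ℝ, EG)) (x := (1 : G))
  rw [← tangentMap_conj, ← tangentMap_conj, ← tangentMap_conj, ← tangentMap_comp_at]
  · congr 1
    funext x
    simp [mul_assoc]
  · exact (contMDiff_conj g).mdifferentiable (by simp) _
  · exact (contMDiff_conj h).mdifferentiable (by simp) _

/-- Conjugation is jointly smooth, so its derivative in `x` depends smoothly on `g` in tangent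
coordinates. Source and target points are always `1`, so these coordinates change nothing. -/
theorem contMDiff_Ad : ContMDiff 𝓘(ℝ, EG) 𝓘(ℝ, EG →L[ℝ] EG) ∞ (Ad : G → EG →L[ℝ] EG) := by
  have : IsManifold 𝓘(ℝ, EG) 1 G := IsManifold.of_le (n := ∞) (by simp)
  intro g₀
  have h : ContMDiffAt 𝓘(ℝ, EG) 𝓘(ℝ, EG →L[ℝ] EG) ∞ (inTangentCoordinates 𝓘(ℝ, EG) 𝓘(ℝ, EG)
      (fun _ => (1 : G)) (fun g => g * 1 * g⁻¹) (fun g => (Ad g : EG →L[ℝ] EG)) g₀) g₀ :=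
    ContMDiffAt.mfderiv (J := 𝓘(ℝ, EG)) (I := 𝓘(ℝ, EG)) (I' := 𝓘(ℝ, EG)) (m := ∞) (n := ∞)
    (x₀ := g₀) (fun g x : G => g * x * g⁻¹) (fun _ => 1)
    (((contMDiff_fst.mul contMDiff_snd).mul contMDiff_fst.inv).contMDiffAt) contMDiffAt_const
    (by simp)
  refine h.congr_of_eventuallyEq (Filter.Eventually.of_forall fun g => ?_)
  have hcc : ∀ (a b : G) (v : EG), a = 1 → b = 1 →
      (tangentBundleCore 𝓘(ℝ, EG) G).coordChange (achart EG a) (achart EG b) a v = v := by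
    rintro a b v rfl rfl
    exact (tangentBundleCore 𝓘(ℝ, EG) G).coordChange_self _ _ (mem_chart_source EG (1 : G)) v
  have h1 : ∀ g : G, g * 1 * g⁻¹ = 1 := fun g => by simp
  rw [inTangentCoordinates_eq]
  · ext v
    simp only [ContinuousLinearMap.comp_apply]
    rw [hcc 1 1 v rfl rfl]
    exact (hcc _ _ _ (h1 g) (h1 g₀)).symm
  · exact mem_chart_source EG (1 : G)
  · rw [h1, h1]
    exact mem_chart_source EG (1 : G)

theorem isSmoothAction_adAction :
    IsSmoothAction (EG := EG) 𝓘(ℝ, EG) (adAction : G → EG → EG) where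
  one A := by rw [adAction, Ad_one]; rfl
  mul := Ad_mul_apply
  smooth := (contMDiff_Ad.comp contMDiff_fst).clm_apply contMDiff_snd

theorem isSmoothAction_coadAction :
    IsSmoothAction (EG := EG) 𝓘(ℝ, EG →L[ℝ] ℝ)
      (coadAction : G → (EG →L[ℝ] ℝ) → (EG →L[ℝ] ℝ)) where
  one α := by rw [coadAction, inv_one, Ad_one]; rfl
  mul g h α := by
    ext A
    simp [coadAction, Ad_mul_apply]
  smooth := contMDiff_snd.clm_comp ((contMDiff_Ad.comp contMDiff_fst.inv))

/-- Differentiate `g • x • f = (g * x * g⁻¹) • g • f` in `x` at `1`. -/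
theorem tangentAction_fundamentalVector (g : G) (A : EG) (f : F) :
    tangentAction g (⟨f, fundamentalVector G A f⟩ : TangentBundle 𝓘(ℝ, EF) F) =
      ⟨g • f, fundamentalVector G (Ad g A) (g • f)⟩ := by
  rw [tangentAction, ← tangentMap_smul_right, ← tangentMap_smul_right, ← tangentMap_conj,
    ← tangentMap_comp_at, ← tangentMap_comp_at]
  · congr 1
    funext x
    simp [mul_smul]
  · exact (contMDiff_smul_right _).mdifferentiable (by simp) _
  · exact (contMDiff_conj g).mdifferentiable (by simp) _
  · exact ((isSmoothAction_leftAction (EG := EG)).contMDiff_apply g).mdifferentiable (by simp) _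
  · exact (contMDiff_smul_right _).mdifferentiable (by simp) _

variable [IsManifold 𝓘(ℝ, EF) ∞ F]

theorem isSmoothAction_tangentAction :
    IsSmoothAction (EG := EG) 𝓘(ℝ, EF).tangent
      (tangentAction : G → TangentBundle 𝓘(ℝ, EF) F → TangentBundle 𝓘(ℝ, EF) F) where
  one v := by
    have h : (fun f : F => (1 : G) • f) = id := funext fun f => one_smul G f
    rw [tangentAction, h, tangentMap_id]
    rfl
  mul g h v := by
    rw [tangentAction, tangentAction, tangentAction, ← tangentMap_comp_at]
    · congr 1
      funext f
      exact mul_smul g h f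
    · exact ((isSmoothAction_leftAction (EG := EG)).contMDiff_apply g).mdifferentiable (by simp) _
    · exact ((isSmoothAction_leftAction (EG := EG)).contMDiff_apply h).mdifferentiable (by simp) _
  smooth := by
    have : IsManifold 𝓘(ℝ, EG) 1 G := IsManifold.of_le (n := ∞) (by simp)
    have : IsManifold 𝓘(ℝ, EF) 1 F := IsManifold.of_le (n := ∞) (by simp)
    have hsm : ContMDiff (𝓘(ℝ, EG).prod 𝓘(ℝ, EF)) 𝓘(ℝ, EF) ∞ fun z : G × F => z.1 • z.2 :=
      contMDiff_smul
    -- The induced action is the tangent map of `G × F → F` restricted to zero vectors along `G`.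
    have h := (contMDiff_tangentMap_infty hsm).comp (contMDiff_equivTangentBundleProd_symm.comp
      (((Bundle.contMDiff_zeroSection ℝ (TangentSpace 𝓘(ℝ, EG) (M := G))).comp
        contMDiff_fst).prodMk contMDiff_snd))
    refine h.congr fun z => ?_
    exact (tangentMap_prod_zero_left z.1 z.2 (hsm.mdifferentiable (by simp) _)).symm

/-- The fundamental vector fields depend smoothly on all data. -/
theorem contMDiff_fundamentalVector :
    ContMDiff (𝓘(ℝ, EG).prod 𝓘(ℝ, EF)) 𝓘(ℝ, EF).tangent ∞
      fun z : EG × F => (⟨z.2, fundamentalVector G z.1 z.2⟩ : TangentBundle 𝓘(ℝ, EF) F) := by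
  have : IsManifold 𝓘(ℝ, EG) 1 G := IsManifold.of_le (n := ∞) (by simp)
  have : IsManifold 𝓘(ℝ, EF) 1 F := IsManifold.of_le (n := ∞) (by simp)
  have hsm : ContMDiff (𝓘(ℝ, EG).prod 𝓘(ℝ, EF)) 𝓘(ℝ, EF) ∞ fun z : G × F => z.1 • z.2 :=
    contMDiff_smul
  have h := (contMDiff_tangentMap_infty hsm).comp (contMDiff_equivTangentBundleProd_symm.comp
    (((contMDiff_tangentBundle_mk (1 : G)).comp contMDiff_fst).prodMk
      ((Bundle.contMDiff_zeroSection ℝ (TangentSpace 𝓘(ℝ, EF) (M := F))).comp contMDiff_snd)))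
  refine h.congr fun z => ?_
  rw [← tangentMap_smul_right]
  exact (tangentMap_prod_zero_right (⟨1, z.1⟩ : TangentBundle 𝓘(ℝ, EG) G) z.2
    (hsm.mdifferentiable (by simp) _)).symm

end Actions

end GaugeMomentum

/-! ### Differentiation under the integral sign -/

namespace GaugeMomentum

section Integral

open MeasureTheory

variable {E H M : Type*} [NormedAddCommGroup E] [NormedSpace ℝ E] [TopologicalSpace H]
  {I : ModelWithCorners ℝ E H} [TopologicalSpace M] [ChartedSpace H M] [IsManifold I ∞ M]

/-- The derivative in `t` is the tangent map of `K` on the unit vector along `ℝ` paired with the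
zero vector along `M`; all maps involved are continuous. -/
theorem continuous_deriv_of_contMDiff {K : ℝ × M → ℝ}
    (hK : ContMDiff (𝓘(ℝ, ℝ).prod I) 𝓘(ℝ, ℝ) ∞ K) :
    Continuous fun z : ℝ × M => deriv (fun t => K (t, z.2)) z.1 := by
  have : IsManifold I 1 M := IsManifold.of_le (n := ∞) (by simp)
  have h1 : Continuous fun t : ℝ => (⟨t, (1 : ℝ)⟩ : TangentBundle 𝓘(ℝ, ℝ) ℝ) :=
    (tangentBundleModelSpaceHomeomorph 𝓘(ℝ, ℝ)).symm.continuous.comp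
      (Continuous.prodMk_left (1 : ℝ))
  have h2 : Continuous (Bundle.zeroSection E (TangentSpace I (M := M))) :=
    (Bundle.contMDiff_zeroSection (n := ∞) (IB := I) ℝ (TangentSpace I (M := M))).continuous
  have h3 : Continuous (equivTangentBundleProd 𝓘(ℝ, ℝ) ℝ I M).symm :=
    (contMDiff_equivTangentBundleProd_symm (n := ∞)).continuous
  have h4 := (continuous_mfderiv_apply hK).comp (h3.comp
    ((h1.comp continuous_fst).prodMk (h2.comp continuous_snd)))
  refine h4.congr fun z => ?_
  have h5 := tangentMap_prod_zero_right (f := K) (⟨z.1, (1 : ℝ)⟩ : TangentBundle 𝓘(ℝ, ℝ) ℝ) z.2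
    (hK.mdifferentiable (by simp) _)
  have h6 := congrArg (fun v => (tangentBundleModelSpaceHomeomorph 𝓘(ℝ, ℝ) v).2) h5
  refine Eq.trans h6 ?_
  change (mfderiv 𝓘(ℝ, ℝ) 𝓘(ℝ, ℝ) (fun t => K (t, z.2)) z.1) (1 : ℝ) = _
  rw [mfderiv_eq_fderiv]
  rfl

/-- Differentiation under the integral sign over a compact manifold. -/
theorem hasDerivAt_integral_of_contMDiff [CompactSpace M] [MeasurableSpace M] [BorelSpace M]
    (μ : Measure M) [IsFiniteMeasure μ] {K : ℝ × M → ℝ}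
    (hK : ContMDiff (𝓘(ℝ, ℝ).prod I) 𝓘(ℝ, ℝ) ∞ K) :
    HasDerivAt (fun t => ∫ m, K (t, m) ∂μ) (∫ m, deriv (fun t => K (t, m)) 0 ∂μ) 0 := by
  have hD := continuous_deriv_of_contMDiff hK
  -- Any compact neighbourhood of `0` would do: the derivative is bounded on its product with `M`,
  -- and this bound is the dominating constant.
  obtain ⟨C, hC⟩ := ((isCompact_Icc (a := (-1 : ℝ)) (b := 1)).prod
    (isCompact_univ (X := M))).exists_bound_of_continuousOn hD.continuousOn
  have hKt : ∀ t, Continuous fun m => K (t, m) := fun t =>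
    hK.continuous.comp (Continuous.prodMk_right t)
  refine (hasDerivAt_integral_of_dominated_loc_of_deriv_le (μ := μ) (F := fun t m => K (t, m))
    (F' := fun t m => deriv (fun t => K (t, m)) t) (bound := fun _ => C) (x₀ := 0)
    (Icc_mem_nhds (by norm_num : (-1 : ℝ) < 0) one_pos)
    (Filter.Eventually.of_forall fun t => (hKt t).aestronglyMeasurable)
    ((hKt 0).integrable_of_hasCompactSupport (HasCompactSupport.of_compactSpace _))
    (hD.comp (Continuous.prodMk_right 0)).aestronglyMeasurable
    (Filter.Eventually.of_forall fun m t ht => hC (t, m) ⟨ht, trivial⟩)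
    (integrable_const C) (Filter.Eventually.of_forall fun m t _ => ?_)).2
  have hsm : ContMDiff 𝓘(ℝ, ℝ) 𝓘(ℝ, ℝ) ∞ fun t => K (t, m) :=
    hK.comp (contMDiff_id.prodMk contMDiff_const)
  exact (hsm.contDiff.differentiable (by simp) t).hasDerivAt

end Integral

/-! ### The pairing of the gauge algebra with its dual -/

namespace PrincipalBundle

variable {n : ℕ} {EG EP G P M : Type*}
  [NormedAddCommGroup EG] [NormedSpace ℝ EG] [NormedAddCommGroup EP] [NormedSpace ℝ EP]
  [Group G] [TopologicalSpace G] [ChartedSpace EG G]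
  [TopologicalSpace P] [ChartedSpace EP P] [MulAction Gᵐᵒᵖ P]
  [TopologicalSpace M] [ChartedSpace (EuclideanSpace ℝ (Fin n)) M]
  {B : PrincipalBundle n EG EP G P M}

/-- The orbit map `g ↦ p g` has a smooth left inverse near the fibre through `p`. -/
theorem exists_smooth_orbit_inverse [LieGroup 𝓘(ℝ, EG) ∞ G]
    (B : PrincipalBundle n EG EP G P M) (p : P) :
    ∃ (W : Set P) (h : P → G), IsOpen W ∧ (∀ q, B.proj q = B.proj p → q ∈ W) ∧
      ContMDiffOn 𝓘(ℝ, EP) 𝓘(ℝ, EG) ∞ h W ∧ ∀ g, h (p <• g) = g := by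
  obtain ⟨U, e, hU, hm, hs, -, he, -, h⟩ := B.locally_trivial (B.proj p)
  refine ⟨e.source, fun q => (e p).2⁻¹ * (e q).2, ?_, fun q hq => ?_, ?_, fun g => ?_⟩
  · rw [hs]
    exact hU.preimage B.smooth_proj.continuous
  · rw [hs]
    change B.proj q ∈ U
    rwa [hq]
  · exact contMDiffOn_const.mul (contMDiff_snd.comp_contMDiffOn he)
  · beta_reduce
    rw [(h p (by rw [hs]; exact hm)).2 g, inv_mul_cancel_left]

section Pairing

variable [LieGroup 𝓘(ℝ, EG) ∞ G]

/-- The adjoint and coadjoint factors cancel. This replaces the arbitrary `B.point` by any point of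
the fibre, in particular by a smooth local lift. -/
theorem fibrePairing_proj (Y : B.GaugeAlgebra) (η : B.CoGaugeAlgebra) (p : P) :
    fibrePairing Y η (B.proj p) = η.at p (Y.at p) := by
  obtain ⟨g, hg⟩ := (B.proj_eq_iff (B.point (B.proj p)) p).1 (B.proj_point _)
  conv_rhs => rw [hg]
  rw [Sec.at_smul isSmoothAction_coadAction, Sec.at_smul isSmoothAction_adAction, fibrePairing,
    coadAction, adAction, ContinuousLinearMap.comp_apply, ← Ad_mul_apply, inv_inv, mul_inv_cancel,
    Ad_one, ContinuousLinearMap.id_apply]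

variable {EN HN N : Type*} [NormedAddCommGroup EN] [NormedSpace ℝ EN] [TopologicalSpace HN]
  {IN : ModelWithCorners ℝ EN HN} [TopologicalSpace N] [ChartedSpace HN N]

theorem contMDiff_fibrePairing_family (Y : B.GaugeAlgebra) {c : N → B.CoGaugeAlgebra}
    (hc : IsSmoothFamily IN c) :
    ContMDiff (IN.prod (𝓡 n)) 𝓘(ℝ, ℝ) ∞ fun z : N × M => fibrePairing Y (c z.1) z.2 := by
  intro z₀
  obtain ⟨U, a, hU, hz, ha, hp⟩ := B.exists_local_section z₀.2
  have h1 := hc.contMDiffOn_at isSmoothAction_coadAction hU ha hp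
  have h2 := (Y.contMDiffOn_at isSmoothAction_adAction hU ha hp).comp
    (contMDiff_snd (I := IN) (M := N)).contMDiffOn subset_rfl
  have h3 : ContMDiffOn (IN.prod (𝓡 n)) 𝓘(ℝ, ℝ) ∞
      (fun z : N × M => fibrePairing Y (c z.1) z.2) (Prod.snd ⁻¹' U) := by
    refine (h1.clm_apply h2).congr fun z hzU => ?_
    have := fibrePairing_proj Y (c z.1) (a z.2)
    rwa [hp z.2 hzU] at this
  exact h3.contMDiffAt ((hU.preimage continuous_snd).mem_nhds hz)

theorem continuous_fibrePairing (Y : B.GaugeAlgebra) (η : B.CoGaugeAlgebra) :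
    Continuous (fibrePairing Y η) := by
  have hc : IsSmoothFamily 𝓘(ℝ, ℝ) fun _ : ℝ => η := η.smooth.comp contMDiff_snd
  exact (contMDiff_fibrePairing_family Y hc).continuous.comp (Continuous.prodMk_right (0 : ℝ))

end Pairing

section Separation

variable {EX : Type*} [NormedAddCommGroup EX] [NormedSpace ℝ EX] {ρ : G → EX → EX}
  [IsManifold (𝓡 n) ∞ M] [T2Space M] [CompactSpace M] [MeasurableSpace M] [BorelSpace M]

/-- A field of linear functionals on the fibres which does not vanish at a point has positive
integral along a suitable section. -/
theorem exists_smoothSec_integral_pos (μ : VolumeForm n M)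
    (hρ : IsSmoothAction (EG := EG) 𝓘(ℝ, EX) ρ) (hρ0 : ∀ g, ρ g 0 = 0) {l : P → EX → ℝ}
    (hl : ∀ p (r : ℝ) v, l p (r • v) = r * l p v) {Δ : B.SmoothSec 𝓘(ℝ, EX) ρ → M → ℝ}
    (hΔ : ∀ s, Continuous (Δ s)) (hΔl : ∀ s p, Δ s (B.proj p) = l p (s.at p))
    (hcont : ∀ (U : Set M) (a : M → P), IsOpen U → ContMDiffOn (𝓡 n) 𝓘(ℝ, EP) ∞ a U →
      (∀ z ∈ U, B.proj (a z) = z) → ∀ v, ContinuousOn (fun z => l (a z) v) U)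
    {m₀ : M} (hm₀ : ∀ p, B.proj p = m₀ → ∃ v, 0 < l p v) :
    ∃ s, 0 < ∫ m, Δ s m ∂μ.measure := by
  obtain ⟨U, a, hU, hmU, ha, hp⟩ := B.exists_local_section m₀
  obtain ⟨v, hv⟩ := hm₀ (a m₀) (hp m₀ hmU)
  -- The functional stays positive on `v` near `m₀`; a bump function supported there makes the
  -- integrand non-negative everywhere and non-zero at `m₀`.
  have hU' : IsOpen (U ∩ (fun z => l (a z) v) ⁻¹' Set.Ioi 0) :=
    (hcont U a hU ha hp v).isOpen_inter_preimage hU isOpen_Ioi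
  obtain ⟨χ, -, hχ⟩ := (SmoothBumpFunction.nhds_basis_tsupport (I := 𝓡 n) m₀).mem_iff.1
    (hU'.mem_nhds ⟨hmU, hv⟩)
  obtain ⟨s, hs, hs0⟩ := exists_smoothSec_of_cutoff B hρ hρ0 hU ha hp χ.contMDiff
    (hχ.trans Set.inter_subset_left) v
  have hin : ∀ m ∈ U, Δ s m = χ m * l (a m) v := fun m hm => by
    have := hΔl s (a m)
    rwa [hs m hm, hl, hp m hm] at this
  refine ⟨s, (hΔ s).integral_pos_of_hasCompactSupport_nonneg_nonzero
    (HasCompactSupport.of_compactSpace _) (fun m => ?_) (x := m₀) ?_⟩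
  · by_cases hm : m ∈ U
    · rw [hin m hm]
      by_cases hχm : χ m = 0
      · simp [hχm]
      · exact mul_nonneg χ.nonneg (hχ (subset_tsupport _ hχm)).2.le
    · obtain ⟨p, rfl⟩ := B.exists_proj_eq m
      rw [hΔl, hs0 p hm, ← zero_smul ℝ (0 : EX), hl, zero_mul]
      rfl
  · rw [hin m₀ hmU, χ.eq_one, one_mul]
    exact hv.ne'

variable [LieGroup 𝓘(ℝ, EG) ∞ G]

theorem integrable_fibrePairing (μ : VolumeForm n M) (Y : B.GaugeAlgebra) (η : B.CoGaugeAlgebra) :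
    MeasureTheory.Integrable (fibrePairing Y η) μ.measure :=
  μ.integrable_of_continuous (continuous_fibrePairing Y η)

theorem pairing_separating_left (μ : VolumeForm n M) {Y₁ Y₂ : B.GaugeAlgebra}
    (h : ∀ η : B.CoGaugeAlgebra, pairing μ Y₁ η = pairing μ Y₂ η) : Y₁ = Y₂ := by
  by_contra hne
  obtain ⟨m₀, hm₀⟩ : ∃ m, Y₁.toFun m ≠ Y₂.toFun m := by
    by_contra! hall
    exact hne (SmoothSec.ext (funext hall))
  obtain ⟨η, hη⟩ := exists_smoothSec_integral_pos (B := B) μ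
    (isSmoothAction_coadAction (G := G) (EG := EG))
    (fun g => ContinuousLinearMap.zero_comp _)
    (l := fun p α => α (Y₁.at p - Y₂.at p)) (fun p r α => rfl)
    (Δ := fun η m => fibrePairing Y₁ η m - fibrePairing Y₂ η m)
    (fun η => (continuous_fibrePairing Y₁ η).sub (continuous_fibrePairing Y₂ η))
    (fun η p => by rw [fibrePairing_proj, fibrePairing_proj, map_sub])
    (fun U a hU ha hp α => α.continuous.comp_continuousOn
      ((Y₁.contMDiffOn_at isSmoothAction_adAction hU ha hp).continuousOn.sub
        (Y₂.contMDiffOn_at isSmoothAction_adAction hU ha hp).continuousOn))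
    (m₀ := m₀) (fun p hp => by
      have hne : Y₁.at p - Y₂.at p ≠ 0 := sub_ne_zero.2 fun heq => hm₀ (by
        rw [← hp, ← Y₁.cls_at, ← Y₂.cls_at, heq])
      -- Hahn–Banach: some functional takes the value `1` on the difference.
      obtain ⟨α, hα⟩ := SeparatingDual.exists_eq_one (R := ℝ) hne
      exact ⟨α, by rw [hα]; exact one_pos⟩)
  rw [MeasureTheory.integral_sub (integrable_fibrePairing μ Y₁ η)
    (integrable_fibrePairing μ Y₂ η)] at hη
  exact (sub_pos.1 hη).ne' (h η)

theorem pairing_separating_right (μ : VolumeForm n M) {η₁ η₂ : B.CoGaugeAlgebra}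
    (h : ∀ Y : B.GaugeAlgebra, pairing μ Y η₁ = pairing μ Y η₂) : η₁ = η₂ := by
  by_contra hne
  obtain ⟨m₀, hm₀⟩ : ∃ m, η₁.toFun m ≠ η₂.toFun m := by
    by_contra! hall
    exact hne (SmoothSec.ext (funext hall))
  obtain ⟨Y, hY⟩ := exists_smoothSec_integral_pos (B := B) μ
    (isSmoothAction_adAction (G := G) (EG := EG)) (fun g => map_zero (Ad g))
    (l := fun p A => (η₁.at p - η₂.at p) A) (fun p r A => map_smul _ r A)
    (Δ := fun Y m => fibrePairing Y η₁ m - fibrePairing Y η₂ m)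
    (fun Y => (continuous_fibrePairing Y η₁).sub (continuous_fibrePairing Y η₂))
    (fun Y p => by rw [fibrePairing_proj, fibrePairing_proj]; rfl)
    (fun U a hU ha hp A => ((η₁.contMDiffOn_at isSmoothAction_coadAction hU ha hp).continuousOn.sub
        (η₂.contMDiffOn_at isSmoothAction_coadAction hU ha hp).continuousOn).clm_apply
          continuousOn_const)
    (m₀ := m₀) (fun p hp => by
      have hne : η₁.at p - η₂.at p ≠ 0 := sub_ne_zero.2 fun heq => hm₀ (by
        rw [← hp, ← η₁.cls_at, ← η₂.cls_at, heq])
      obtain ⟨A, hA⟩ := DFunLike.ne_iff.1 hne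
      rcases lt_or_gt_of_ne hA with hA | hA
      · exact ⟨-A, by rw [map_neg]; exact neg_pos.2 hA⟩
      · exact ⟨A, hA⟩)
  rw [MeasureTheory.integral_sub (integrable_fibrePairing μ Y η₁)
    (integrable_fibrePairing μ Y η₂)] at hY
  exact (sub_pos.1 hY).ne' (h Y)

theorem isDualPairing (B : PrincipalBundle n EG EP G P M) (μ : VolumeForm n M) :
    IsDualPairing B μ where
  integrable := integrable_fibrePairing μ
  linear_left a b Y₁ Y₂ Y η hY := by
    rw [pairing, pairing, pairing, ← MeasureTheory.integral_const_mul,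
      ← MeasureTheory.integral_const_mul, ← MeasureTheory.integral_add
      ((integrable_fibrePairing μ Y₁ η).const_mul a) ((integrable_fibrePairing μ Y₂ η).const_mul b)]
    congr 1
    funext m
    simp only [fibrePairing, hY, map_add, map_smul, smul_eq_mul]
  linear_right a b Y η₁ η₂ η hη := by
    rw [pairing, pairing, pairing, ← MeasureTheory.integral_const_mul,
      ← MeasureTheory.integral_const_mul, ← MeasureTheory.integral_add
      ((integrable_fibrePairing μ Y η₁).const_mul a) ((integrable_fibrePairing μ Y η₂).const_mul b)]
    congr 1
    funext m
    simp only [fibrePairing, hη]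
    rfl
  separating_left _ _ := pairing_separating_left μ
  separating_right _ _ := pairing_separating_right μ

end Separation

end PrincipalBundle

end GaugeMomentum

/-! ### Generators of the gauge action and the momentum equation -/

namespace GaugeMomentum

section Hamiltonian

variable {EG : Type*} [NormedAddCommGroup EG] [NormedSpace ℝ EG]
  {G : Type*} [Group G] [TopologicalSpace G] [ChartedSpace EG G]
  {EF : Type*} [NormedAddCommGroup EF] [NormedSpace ℝ EF]
  {F : Type*} [TopologicalSpace F] [ChartedSpace EF F] [MulAction G F]
  (S : HamiltonianStructure EG G EF F)

theorem HamiltonianStructure.eval_tangentAction (g : G) {a b : TangentBundle 𝓘(ℝ, EF) F}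
    (hab : a.proj = b.proj) : S.eval (tangentAction g a) (tangentAction g b) = S.eval a b := by
  obtain ⟨f, u⟩ := a
  obtain ⟨f', v⟩ := b
  obtain rfl : f = f' := hab
  exact S.invariant g f u v

theorem HamiltonianStructure.eval_fundamentalVector (A : EG) (v : TangentBundle 𝓘(ℝ, EF) F) :
    S.eval ⟨v.proj, fundamentalVector G A v.proj⟩ v =
      -(show EG →L[ℝ] ℝ from mfderiv 𝓘(ℝ, EF) 𝓘(ℝ, EG →L[ℝ] ℝ) S.J v.proj v.snd) A :=
  eq_neg_of_add_eq_zero_left (S.momentum A v.proj v.snd)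

end Hamiltonian

namespace PrincipalBundle

variable {n : ℕ} {EG EP G P M : Type*}
  [NormedAddCommGroup EG] [NormedSpace ℝ EG] [NormedAddCommGroup EP] [NormedSpace ℝ EP]
  [Group G] [TopologicalSpace G] [ChartedSpace EG G]
  [TopologicalSpace P] [ChartedSpace EP P] [MulAction Gᵐᵒᵖ P]
  [TopologicalSpace M] [ChartedSpace (EuclideanSpace ℝ (Fin n)) M]
  {B : PrincipalBundle n EG EP G P M}
  {EF F : Type*} [NormedAddCommGroup EF] [NormedSpace ℝ EF]
  [TopologicalSpace F] [ChartedSpace EF F] [MulAction G F]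

/-- A local lift `(a, x)` of `φ` becomes the lift `(ψ_t a, x)`: only the component in `P` moves. -/
theorem isSmoothFamily_gauge_smul {ψ : ℝ → B.GaugeGroup}
    (hψ : ContMDiff (𝓘(ℝ, ℝ).prod 𝓘(ℝ, EP)) 𝓘(ℝ, EP) ∞ fun z : ℝ × P => (ψ z.1).1 z.2)
    (φ : B.Sections EF F) : IsSmoothFamily 𝓘(ℝ, ℝ) fun t => ψ t • φ := by
  rintro ⟨t, m⟩
  obtain ⟨U, hU, a, x, ha, hx, h⟩ := φ.smooth m
  refine ⟨Prod.snd ⁻¹' U, continuous_snd.continuousAt hU, fun z => (ψ z.1).1 (a z.2),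
    fun z => x z.2, hψ.comp_contMDiffOn (contMDiff_fst.contMDiffOn.prodMk
      (ha.comp contMDiff_snd.contMDiffOn subset_rfl)),
    hx.comp contMDiff_snd.contMDiffOn subset_rfl, fun z hz => ?_⟩
  change gaugeMap (ψ z.1) (φ.toFun z.2) = _
  rw [h z.2 hz]
  rfl

theorem fibrePairing_momentumMap_proj [LieGroup 𝓘(ℝ, EG) ∞ G]
    (S : HamiltonianStructure EG G EF F) (Y : B.GaugeAlgebra)
    (φ : B.Sections EF F) (p : P) :
    fibrePairing Y (momentumMap S φ) (B.proj p) = S.J (φ.at p) (Y.at p) := by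
  rw [fibrePairing_proj]
  exact congrArg (fun α : EG →L[ℝ] ℝ => α (Y.at p))
    (pushforward_at isSmoothAction_coadAction S.equivariant_J S.smooth_J φ p)

variable [ContMDiffSMul 𝓘(ℝ, EG) 𝓘(ℝ, EF) ∞ G F]

theorem gauge_smul_at (ψ : B.GaugeGroup) (φ : B.Sections EF F) {p : P} {g : G}
    (h : ψ.1 p = p <• g) : (ψ • φ).at p = g • φ.at p := by
  apply Sec.at_eq (isSmoothAction_leftAction (EG := EG) (EF := EF))
  change gaugeMap ψ (φ.toFun (B.proj p)) = _
  rw [← φ.cls_at]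
  change B.cls _ (ψ.1 p) _ = _
  rw [h, B.cls_smul_left (isSmoothAction_leftAction (EG := EG) (EF := EF))]
  rfl

theorem TangentVector.proj_at
    [IsManifold 𝓘(ℝ, EF) ∞ F] {φ : B.Sections EF F} (Z : TangentVector φ) (p : P) :
    (Z.at p).proj = φ.at p := by
  symm
  apply Sec.at_eq (isSmoothAction_leftAction (EG := EG) (EF := EF))
  rw [← Z.base_eq, ← Z.cls_at]
  rfl

variable [LieGroup 𝓘(ℝ, EG) ∞ G]

/-- The velocity of a curve of gauge transformations, in terms of a curve in the group. -/
theorem IsGaugeCurve.exists_group_curve {ψ : ℝ → B.GaugeGroup} {Y : B.GaugeAlgebra}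
    (hψ : IsGaugeCurve ψ Y) (p : P) : ∃ g : ℝ → G, ContMDiff 𝓘(ℝ, ℝ) 𝓘(ℝ, EG) ∞ g ∧
      (∀ t, (ψ t).1 p = p <• g t) ∧
      tangentMap 𝓘(ℝ, ℝ) 𝓘(ℝ, EG) g ⟨0, (1 : ℝ)⟩ = ⟨1, (Y.at p : EG)⟩ := by
  obtain ⟨hsm, h0, hvel⟩ := hψ
  obtain ⟨W, h, hW, hpW, hh, hinv⟩ := B.exists_smooth_orbit_inverse p
  have hcurve : ContMDiff 𝓘(ℝ, ℝ) 𝓘(ℝ, EP) ∞ fun t => (ψ t).1 p :=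
    hsm.comp (contMDiff_id.prodMk contMDiff_const)
  have hmem : ∀ t, (ψ t).1 p ∈ W := fun t => hpW _ ((ψ t).2.2.2.2 p)
  have horbit : ContMDiff 𝓘(ℝ, EG) 𝓘(ℝ, EP) ∞ fun g : G => p <• g :=
    B.smooth_action.comp (contMDiff_const.prodMk contMDiff_id)
  have hdiff : ∀ q ∈ W, MDifferentiableAt 𝓘(ℝ, EP) 𝓘(ℝ, EG) h q := fun q hq =>
    (hh.contMDiffAt (hW.mem_nhds hq)).mdifferentiableAt (by simp)
  refine ⟨fun t => h ((ψ t).1 p), ?_, fun t => ?_, ?_⟩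
  · rw [← contMDiffOn_univ]
    exact hh.comp hcurve.contMDiffOn fun t _ => hmem t
  · obtain ⟨g, hg⟩ := (B.proj_eq_iff p ((ψ t).1 p)).1 ((ψ t).2.2.2.2 p).symm
    exact hg.trans (congrArg (p <• ·) ((congrArg h hg).trans (hinv g)).symm)
  -- Apply the tangent map of `h` to the velocity condition; on the right-hand side `h` undoes the
  -- orbit map, which leaves the vector `Y.at p` at `1`.
  · have h1 := tangentMap_comp_at (I := 𝓘(ℝ, ℝ)) (I' := 𝓘(ℝ, EP)) (I'' := 𝓘(ℝ, EG)) (g := h)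
      (⟨0, (1 : ℝ)⟩ : TangentBundle 𝓘(ℝ, ℝ) ℝ) (hdiff _ (hmem 0))
      (hcurve.mdifferentiable (by simp) _)
    have h2 := tangentMap_comp_at (I := 𝓘(ℝ, EG)) (I' := 𝓘(ℝ, EP)) (I'' := 𝓘(ℝ, EG)) (g := h)
      (⟨1, (Y.at p : EG)⟩ : TangentBundle 𝓘(ℝ, EG) G)
      (hdiff _ (hpW _ (B.proj_smul p 1))) (horbit.mdifferentiable (by simp) _)
    refine h1.trans ((congrArg _ (hvel p)).trans (h2.symm.trans ?_))
    have h3 : (h ∘ fun g : G => p <• g) = id := funext hinv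
    rw [h3, tangentMap_id]
    rfl

theorem tangentMap_gauge_smul_at {ψ : ℝ → B.GaugeGroup} {Y : B.GaugeAlgebra}
    (hψ : IsGaugeCurve ψ Y) (φ : B.Sections EF F) (p : P) :
    tangentMap 𝓘(ℝ, ℝ) 𝓘(ℝ, EF) (fun t => (ψ t • φ).at p) ⟨0, (1 : ℝ)⟩ =
      ⟨φ.at p, fundamentalVector G (Y.at p) (φ.at p)⟩ := by
  obtain ⟨g, hg, hψg, hvel⟩ := hψ.exists_group_curve p
  have h1 : (fun t => (ψ t • φ).at p) = (fun x : G => x • φ.at p) ∘ g :=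
    funext fun t => gauge_smul_at (ψ t) φ (hψg t)
  rw [h1, tangentMap_comp_at (I' := 𝓘(ℝ, EG)), hvel, tangentMap_smul_right]
  · exact (contMDiff_smul_right _).mdifferentiable (by simp) _
  · exact hg.mdifferentiable (by simp) _

theorem generatesGaugeAction (B : PrincipalBundle n EG EP G P M) :
    GeneratesGaugeAction B EF F := by
  intro Y φ ψ hψ
  refine ⟨isSmoothFamily_gauge_smul hψ.1 φ, ?_⟩
  apply Sec.ext
  funext m
  exact congrArg (B.cls _ _) (tangentMap_gauge_smul_at hψ φ (B.point m))

theorem pairing_momentumMap_eq [IsManifold (𝓡 n) ∞ M] [T2Space M] [CompactSpace M]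
    [MeasurableSpace M] (S : HamiltonianStructure EG G EF F) (μ : VolumeForm n M)
    (Y : B.GaugeAlgebra) (φ : B.Sections EF F) {p : M → P} {A : M → EG} {f : M → F}
    (h : ∀ m, B.proj (p m) = m ∧ Y.toFun m = B.cls adAction (p m) (A m) ∧
      φ.toFun m = B.cls leftAction (p m) (f m)) :
    pairing μ Y (momentumMap S φ) = ∫ m, S.J (f m) (A m) ∂μ.measure := by
  rw [pairing]
  congr 1
  funext m
  obtain ⟨hp, hA, hf⟩ := h m
  have h1 := fibrePairing_momentumMap_proj S Y φ (p m)
  rwa [Sec.at_eq isSmoothAction_adAction Y.toSec (x := A m) (by rw [hp, hA]),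
    Sec.at_eq (isSmoothAction_leftAction (EG := EG) (EF := EF)) φ.toSec (x := f m)
      (by rw [hp, hf]), hp] at h1

variable [IsManifold 𝓘(ℝ, EF) ∞ F]

/-- `B.point` is a mere choice and need not vary smoothly. Equivariance of fundamental vectors
carries the defining formula to every `p`, so it can be used along smooth local lifts. -/
theorem generator_at (Y : B.GaugeAlgebra) (φ : B.Sections EF F) (p : P) :
    (generator Y φ).at p = ⟨φ.at p, fundamentalVector G (Y.at p) (φ.at p)⟩ := by
  apply Sec.at_eq (isSmoothAction_tangentAction (EG := EG) (EF := EF))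
  obtain ⟨g, hg⟩ := (B.proj_eq_iff (B.point (B.proj p)) p).1 (B.proj_point _)
  conv_rhs => rw [hg]
  rw [Sec.at_smul (isSmoothAction_leftAction (EG := EG) (EF := EF)),
    Sec.at_smul isSmoothAction_adAction]
  refine Eq.trans ?_ (congrArg (B.cls _ _)
    (tangentAction_fundamentalVector (EG := EG) g⁻¹ _ _))
  rw [B.cls_smul]
  rfl

/-- The vector field which generates the action of an element of the gauge algebra is smooth. -/
noncomputable def generatorTangentVector (Y : B.GaugeAlgebra) (φ : B.Sections EF F) :
    TangentVector φ where
  toSec := generator Y φ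
  smooth m := by
    obtain ⟨U, a, hU, hm, ha, hp⟩ := B.exists_local_section m
    refine ⟨U, hU.mem_nhds hm, a, _, ha, (contMDiff_fundamentalVector (G := G)).comp_contMDiffOn
      ((Y.contMDiffOn_at isSmoothAction_adAction hU ha hp).prodMk
        (φ.contMDiffOn_at isSmoothAction_leftAction hU ha hp)), fun z hz => ?_⟩
    have := (generator Y φ).cls_at (a z)
    rw [hp z hz, generator_at] at this
    exact this.symm
  base_eq m := by
    have h := φ.cls_at (B.point m)
    rw [B.proj_point] at h
    exact h

theorem fibreForm_proj (S : HamiltonianStructure EG G EF F) {φ : B.Sections EF F}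
    (Z₁ Z₂ : TangentVector φ) (p : P) :
    fibreForm S Z₁.toSec Z₂.toSec (B.proj p) = S.eval (Z₁.at p) (Z₂.at p) := by
  obtain ⟨g, hg⟩ := (B.proj_eq_iff (B.point (B.proj p)) p).1 (B.proj_point _)
  conv_rhs => rw [hg]
  rw [Sec.at_smul (isSmoothAction_tangentAction (EG := EG) (EF := EF)),
    Sec.at_smul (isSmoothAction_tangentAction (EG := EG) (EF := EF)),
    S.eval_tangentAction _ ((Z₁.proj_at _).trans (Z₂.proj_at _).symm)]
  rfl

/-- The fibrewise momentum equation. -/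
theorem fibreForm_generator_proj (S : HamiltonianStructure EG G EF F) {φ : B.Sections EF F}
    {Y : B.GaugeAlgebra} {Yφ : TangentVector φ} (hY : Yφ.toSec = generator Y φ)
    (Z : TangentVector φ) (p : P) :
    fibreForm S Yφ.toSec Z.toSec (B.proj p) =
      -(show EG →L[ℝ] ℝ from mfderiv 𝓘(ℝ, EF) 𝓘(ℝ, EG →L[ℝ] ℝ) S.J (Z.at p).proj (Z.at p).snd)
        (Y.at p) := by
  rw [fibreForm_proj, hY, generator_at, ← Z.proj_at]
  exact S.eval_fundamentalVector _ _

theorem fibreForm_generator (S : HamiltonianStructure EG G EF F) {φ : B.Sections EF F}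
    {Y : B.GaugeAlgebra} {Yφ : TangentVector φ} (hY : Yφ.toSec = generator Y φ)
    (Z : TangentVector φ) (m : M) :
    fibreForm S Yφ.toSec Z.toSec m = -fibreDerivPairing S Y Z.toSec m := by
  have h := fibreForm_generator_proj S hY Z (B.point m)
  rw [B.proj_point] at h
  exact h

/-- By the fibrewise momentum equation, continuity can be read off from the derivative of `S.J`
along a smooth local lift, without local expressions for the symplectic form. -/
theorem continuous_fibreForm_generator (S : HamiltonianStructure EG G EF F)
    {φ : B.Sections EF F} {Y : B.GaugeAlgebra} {Yφ : TangentVector φ}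
    (hY : Yφ.toSec = generator Y φ) (Z : TangentVector φ) :
    Continuous (fibreForm S Yφ.toSec Z.toSec) := by
  rw [continuous_iff_continuousAt]
  intro m
  obtain ⟨U, a, hU, hm, ha, hp⟩ := B.exists_local_section m
  have h1 := (continuous_mfderiv_apply S.smooth_J).comp_continuousOn
    (Z.contMDiffOn_at isSmoothAction_tangentAction hU ha hp).continuousOn
  have h2 := (h1.clm_apply (Y.contMDiffOn_at isSmoothAction_adAction hU ha hp).continuousOn).neg
  refine ContinuousOn.continuousAt (h2.congr fun z hz => ?_) (hU.mem_nhds hm)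
  have := fibreForm_generator_proj S hY Z (a z)
  rwa [hp z hz] at this

theorem deriv_fibrePairing_momentumMap (S : HamiltonianStructure EG G EF F) (Y : B.GaugeAlgebra)
    {φ : B.Sections EF F} (Z : TangentVector φ) {c : ℝ → B.Sections EF F}
    (hc : IsSmoothFamily 𝓘(ℝ, ℝ) c) (hZ : velocity c 0 = Z.toSec) (m : M) :
    deriv (fun t => fibrePairing Y (momentumMap S (c t)) m) 0 =
      fibreDerivPairing S Y Z.toSec m := by
  set p := B.point m with hp
  have hf : ContMDiff 𝓘(ℝ, ℝ) 𝓘(ℝ, EF) ∞ fun t => (c t).at p :=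
    hc.contMDiff_at isSmoothAction_leftAction p
  -- Since `p` is the point used in `velocity`, the vector `Z.at p` is the velocity of the
  -- coordinate curve, and the chain rule for `S.J` applies.
  have hZp : Z.at p = tangentMap 𝓘(ℝ, ℝ) 𝓘(ℝ, EF) (fun t => (c t).at p) ⟨0, (1 : ℝ)⟩ := by
    apply Sec.at_eq (isSmoothAction_tangentAction (EG := EG) (EF := EF))
    rw [← hZ, hp, B.proj_point]
    rfl
  have hJf : ContMDiff 𝓘(ℝ, ℝ) 𝓘(ℝ, EG →L[ℝ] ℝ) ∞ fun t => S.J ((c t).at p) := S.smooth_J.comp hf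
  have h1 := tangentMap_comp_at (I := 𝓘(ℝ, ℝ)) (I' := 𝓘(ℝ, EF)) (I'' := 𝓘(ℝ, EG →L[ℝ] ℝ))
    (g := S.J) (⟨0, (1 : ℝ)⟩ : TangentBundle 𝓘(ℝ, ℝ) ℝ)
    (S.smooth_J.mdifferentiable (by simp) _) (hf.mdifferentiable (by simp) _)
  rw [← hZp] at h1
  have h2 := congrArg (fun v => (tangentBundleModelSpaceHomeomorph 𝓘(ℝ, EG →L[ℝ] ℝ) v).2) h1
  have h3 : fderiv ℝ (fun t => S.J ((c t).at p)) 0 1 =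
      (show EG →L[ℝ] ℝ from mfderiv 𝓘(ℝ, EF) 𝓘(ℝ, EG →L[ℝ] ℝ) S.J (Z.at p).proj (Z.at p).snd) := by
    rw [← mfderiv_eq_fderiv]
    exact h2
  have h4 : HasDerivAt (fun t => S.J ((c t).at p)) _ 0 :=
    (hJf.contDiff.differentiable (by simp) 0).hasFDerivAt.hasDerivAt
  rw [h3] at h4
  have h5 : (fun t => fibrePairing Y (momentumMap S (c t)) m) =
      fun t => S.J ((c t).at p) (Y.at p) := by
    funext t
    rw [← fibrePairing_momentumMap_proj, hp, B.proj_point]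
  rw [h5]
  exact (h4.clm_apply (hasDerivAt_const _ _)).deriv.trans (by simp; rfl)

variable [IsManifold (𝓡 n) ∞ M] [T2Space M] [CompactSpace M] [MeasurableSpace M]

theorem symplecticForm_generator (S : HamiltonianStructure EG G EF F) (μ : VolumeForm n M)
    {φ : B.Sections EF F} {Y : B.GaugeAlgebra} {Yφ : TangentVector φ}
    (hY : Yφ.toSec = generator Y φ) (Z : TangentVector φ) :
    symplecticForm S μ φ Yφ Z = -∫ m, fibreDerivPairing S Y Z.toSec m ∂μ.measure := by
  rw [symplecticForm, ← MeasureTheory.integral_neg]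
  simp only [fibreForm_generator S hY Z]

variable [BorelSpace M]

theorem isMomentumMap_momentumMap (S : HamiltonianStructure EG G EF F) (μ : VolumeForm n M) :
    IsMomentumMap S μ (momentumMap (B := B) S) := by
  refine ⟨fun _ _ hc => hc.pushforward S.equivariant_J S.smooth_J,
    fun Y φ => ⟨generatorTangentVector Y φ, rfl, fun Z =>
    μ.integrable_of_continuous (continuous_fibreForm_generator S rfl Z), fun Z c hc _ hZ => ?_⟩⟩
  have hK := contMDiff_fibrePairing_family Y (hc.pushforward S.equivariant_J S.smooth_J)
  have h := hasDerivAt_integral_of_contMDiff μ.measure hK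
  have hval : -symplecticForm S μ φ (generatorTangentVector Y φ) Z =
      ∫ m, deriv (fun t => fibrePairing Y (momentumMap S (c t)) m) 0 ∂μ.measure := by
    rw [symplecticForm_generator S μ (Y := Y) rfl Z, neg_neg]
    congr 1
    funext m
    exact (deriv_fibrePairing_momentumMap S Y Z hc hZ m).symm
  exact h.congr_deriv hval.symm

end PrincipalBundle

end GaugeMomentum

open GaugeMomentum PrincipalBundle in
theorem mainTheorem7 {n : ℕ} {EG EP EF G P M F : Type*}
    [NormedAddCommGroup EG] [NormedSpace ℝ EG] [FiniteDimensional ℝ EG]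
    [NormedAddCommGroup EP] [NormedSpace ℝ EP] [FiniteDimensional ℝ EP]
    [NormedAddCommGroup EF] [NormedSpace ℝ EF] [FiniteDimensional ℝ EF]
    -- the finite-dimensional Lie group `G`
    [Group G] [TopologicalSpace G] [ChartedSpace EG G] [LieGroup 𝓘(ℝ, EG) ∞ G]
    -- the closed manifold `M` of dimension `n`
    [TopologicalSpace M] [ChartedSpace (EuclideanSpace ℝ (Fin n)) M] [IsManifold (𝓡 n) ∞ M]
    [T2Space M] [CompactSpace M] [MeasurableSpace M] [BorelSpace M]
    -- the total space `P` of the principal bundle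
    [TopologicalSpace P] [ChartedSpace EP P] [IsManifold 𝓘(ℝ, EP) ∞ P] [MulAction Gᵐᵒᵖ P]
    -- the `G`-manifold `F`
    [TopologicalSpace F] [ChartedSpace EF F] [IsManifold 𝓘(ℝ, EF) ∞ F]
    [MulAction G F] [ContMDiffSMul 𝓘(ℝ, EG) 𝓘(ℝ, EF) ∞ G F]
    (B : PrincipalBundle n EG EP G P M) (μ : VolumeForm n M)
    (S : HamiltonianStructure EG G EF F) :
    GeneratesGaugeAction B EF F ∧
    IsDualPairing B μ ∧
    IsMomentumMap S μ (momentumMap (B := B) S) ∧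
    (∀ (Y : B.GaugeAlgebra) (φ : B.Sections EF F) (Yφ Z : TangentVector φ),
      Yφ.toSec = generator Y φ →
      symplecticForm S μ φ Yφ Z + ∫ m, fibreDerivPairing S Y Z.toSec m ∂μ.measure = 0) ∧
    ∀ (Y : B.GaugeAlgebra) (φ : B.Sections EF F) (p : M → P) (A : M → EG) (f : M → F),
      (∀ m, B.proj (p m) = m ∧ Y.toFun m = B.cls adAction (p m) (A m) ∧
        φ.toFun m = B.cls leftAction (p m) (f m)) →
      pairing μ Y (momentumMap S φ) = ∫ m, S.J (f m) (A m) ∂μ.measure := by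
  exact ⟨generatesGaugeAction B, isDualPairing B μ, isMomentumMap_momentumMap S μ,
    fun Y φ Yφ Z hY => by rw [symplecticForm_generator S μ hY Z, neg_add_cancel],
    fun Y φ p A f h => pairing_momentumMap_eq S μ Y φ h⟩
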